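/- Let $B_n$ be the Artin braid group on $n$ strings with generators $\sigma_1,\dots,\sigma_{n-1}$, let $P_n$ be the pure braid group, i.e. the kernel of $B_n\to S_n$, $\sigma_i\mapsto(i,i+1)$, and let $\Gamma_1(P_n)=P_n$, $\Gamma_{k+1}(P_n)=[\Gamma_k(P_n),P_n]$ be its lower central series. For $1\le i<j\le n$ let $A_{i,j}=\sigma_{j-1}\cdots\sigma_{i+1}\sigma_i^2\sigma_{i+1}^{-1}\cdots\sigma_{j-1}^{-1}$, and for $1\le i<j<k\le n$ let $\alpha_{i,j,k}$ be the class of $[A_{i,j},A_{j,k}]$ in $B_n/\Gamma_3(P_n)$, where $[g,h]=ghg^{-1}h^{-1}$; these elements commute pairwise. For odd $n$ let $\delta_n$ be the class of $\sigma_{n-1}\cdots\sigma_{(n+1)/2}\,\sigma_{(n-1)/2}^{-1}\cdots\sigma_1^{-1}$ in $B_n/\Gamma_3(P_n)$. Theorem. Let $1\le m\le n$, and let $s$ be the largest divisor of $m$ with $\gcd(s,6)=1$. If $s>1$, then $B_n/\Gamma_3(P_n)$ has infinitely many elements of order $s$. More precisely, let $\overline\iota\colon B_s/\Gamma_3(P_s)\to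 B_n/\Gamma_3(P_n)$ be the homomorphism induced by $\sigma_i\mapsto\sigma_i$. Every $\theta\in\Gamma_2(P_s)/\Gamma_3(P_s)$ can be written as $\theta=\theta(r):=\prod_{1\le i<j<k\le s}\alpha_{i,j,k}^{\,r_{i,j,k}}$ for exactly one family of integers $r=(r_{i,j,k})$, and every such product lies in $\Gamma_2(P_s)/\Gamma_3(P_s)$. Moreover there is a family of integers $\mu=(\mu_{i,j,k})$ with $\delta_s^{\,s}=\theta(\mu)$; it is constant on the orbits of the elements $\alpha_{i,j,k}$, $1\le i<j<k\le s$, under conjugation by $\delta_s$; and for every family of integers $r$, the element $\overline\iota(\theta(r)\,\delta_s)$ has order $s$ if and only if, for every such orbit $O$, $$\sum_{\alpha_{i,j,k}\in O} r_{i,j,k}=-\mu_O,$$ where $\mu_O$ is the common value of $\mu$ on $O$. The elements $\overline\iota(\theta(r)\,\delta_s)$ with $r$ satisfying these conditions form an infinite set. -/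

import Mathlib

namespace ArtinBraid

open scoped commutatorElement

/-- The Artin relations. The generator `σ_{i+1}` has index `i : Fin (n - 1)`. -/
def relations (n : ℕ) : Set (FreeGroup (Fin (n - 1))) :=
  {r | ∃ i j : Fin (n - 1), (i : ℕ) + 2 ≤ j ∧
      r = (FreeGroup.of i * FreeGroup.of j) * (FreeGroup.of j * FreeGroup.of i)⁻¹} ∪
  {r | ∃ i j : Fin (n - 1), (i : ℕ) + 1 = j ∧
      r = (FreeGroup.of j * FreeGroup.of i * FreeGroup.of j) *
        (FreeGroup.of i * FreeGroup.of j * FreeGroup.of i)⁻¹}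

/-- The Artin braid group `B_n` on `n` strings. -/
abbrev Braid (n : ℕ) : Type := PresentedGroup (relations n)

/-- The Artin generator `σ_i` of `B_n`, for `1 ≤ i ≤ n - 1` (and `1` outside this range). -/
def sigma (n i : ℕ) : Braid n :=
  if h : 1 ≤ i ∧ i < n then PresentedGroup.of ⟨i - 1, by omega⟩ else 1

/-- The transposition of the `i`-th and `(i+1)`-st elements of `Fin n`, counted from zero. -/
def adjSwap (n : ℕ) (i : Fin (n - 1)) : Equiv.Perm (Fin n) :=
  Equiv.swap ⟨i, by omega⟩ ⟨i + 1, by omega⟩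

theorem adjSwap_relations (n : ℕ) :
    ∀ r ∈ relations n, FreeGroup.lift (adjSwap n) r = 1 := by
  rintro r (⟨i, j, hij, rfl⟩ | ⟨i, j, hij, rfl⟩)
  · simp only [map_mul, map_inv, FreeGroup.lift_apply_of, mul_inv_eq_one]
    refine (Equiv.Perm.Disjoint.commute ?_).eq
    intro x
    by_cases hx : (x : ℕ) = i ∨ (x : ℕ) = i + 1
    · right
      apply Equiv.swap_apply_of_ne_of_ne <;> (intro h; rw [Fin.ext_iff] at h; simp at h; omega)
    · left
      apply Equiv.swap_apply_of_ne_of_ne <;> (intro h; rw [Fin.ext_iff] at h; simp at h; omega)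
  · simp only [map_mul, map_inv, FreeGroup.lift_apply_of, mul_inv_eq_one]
    have hj : (⟨j, by omega⟩ : Fin n) = ⟨i + 1, by omega⟩ := Fin.ext hij.symm
    unfold adjSwap
    rw [hj]
    have h1 : (⟨i, by omega⟩ : Fin n) ≠ ⟨i + 1, by omega⟩ := by
      intro h; rw [Fin.ext_iff] at h; simp at h
    have h2 : (⟨i, by omega⟩ : Fin n) ≠ ⟨j + 1, by omega⟩ := by
      intro h; rw [Fin.ext_iff] at h; simp at h; omega
    have h3 : (⟨j + 1, by omega⟩ : Fin n) ≠ ⟨i + 1, by omega⟩ := by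
      intro h; rw [Fin.ext_iff] at h; simp at h; omega
    rw [Equiv.swap_mul_swap_mul_swap h1 h2,
      Equiv.swap_comm (⟨i, by omega⟩ : Fin n) ⟨i + 1, by omega⟩,
      Equiv.swap_comm (⟨i + 1, by omega⟩ : Fin n) ⟨j + 1, by omega⟩,
      Equiv.swap_mul_swap_mul_swap h3 h2.symm, Equiv.swap_comm]

/-- The homomorphism `B_n → S_n` with `σ_i ↦ (i, i+1)`. Reading products of permutations from
left to right instead of right to left replaces its values by their inverses, so it has the same
kernel under either convention. -/
def perm (n : ℕ) : Braid n →* Equiv.Perm (Fin n) :=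
  PresentedGroup.toGroup (adjSwap_relations n)

/-- The pure braid group `P_n`, as a subgroup of `B_n`. -/
def Pure (n : ℕ) : Subgroup (Braid n) := (perm n).ker

instance (n : ℕ) : (Pure n).Normal := by unfold Pure; infer_instance

/-- The term `Γ_k(P_n)`, `k ≥ 1`, of the lower central series of `P_n`, as a subgroup of `B_n`:
`Γ_1(P_n) = P_n` and `Γ_{k+1}(P_n) = [Γ_k(P_n), P_n]`. -/
def Gam (k n : ℕ) : Subgroup (Braid n) := (Pure n).lowerCentralSeries (k - 1)

theorem lowerCentralSeries_normal {G : Type*} [Group G] (S : Subgroup G) [S.Normal] (k : ℕ) :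
    (S.lowerCentralSeries k).Normal := by
  induction k with
  | zero => simpa
  | succ k ih => rw [Subgroup.lowerCentralSeries_succ]; infer_instance

instance (k n : ℕ) : (Gam k n).Normal := lowerCentralSeries_normal _ _

/-- The group `B_n / Γ_3(P_n)`. -/
abbrev Quot3 (n : ℕ) : Type := Braid n ⧸ Gam 3 n

/-- The subgroup `Γ_2(P_n) / Γ_3(P_n)` of `B_n / Γ_3(P_n)`. -/
def Gam2Quot (n : ℕ) : Subgroup (Quot3 n) := (Gam 2 n).map (QuotientGroup.mk' (Gam 3 n))

theorem sigma_relations {s n : ℕ} (h : s ≤ n) :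
    ∀ r ∈ relations s, FreeGroup.lift (fun i : Fin (s - 1) => sigma n (i + 1)) r = 1 := by
  have key : ∀ i : Fin (s - 1), sigma n (i + 1) =
      PresentedGroup.mk (relations n) (FreeGroup.of ⟨i, by omega⟩) := by
    intro i
    have : 1 ≤ (i : ℕ) + 1 ∧ (i : ℕ) + 1 < n := by omega
    simp only [sigma, this, and_self, dif_pos]
    rfl
  rintro r (⟨i, j, hij, rfl⟩ | ⟨i, j, hij, rfl⟩)
  · simp only [map_mul, map_inv, FreeGroup.lift_apply_of, key]
    simp only [← map_mul, ← map_inv]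
    exact PresentedGroup.one_of_mem (Or.inl ⟨⟨i, by omega⟩, ⟨j, by omega⟩, hij, rfl⟩)
  · simp only [map_mul, map_inv, FreeGroup.lift_apply_of, key]
    simp only [← map_mul, ← map_inv]
    exact PresentedGroup.one_of_mem (Or.inr ⟨⟨i, by omega⟩, ⟨j, by omega⟩, hij, rfl⟩)

/-- The standard homomorphism `B_s → B_n`, `σ_i ↦ σ_i`, for `s ≤ n`. -/
def incl {s n : ℕ} (h : s ≤ n) : Braid s →* Braid n :=
  PresentedGroup.toGroup (sigma_relations h)

theorem incl_of {s n : ℕ} (h : s ≤ n) (i : Fin (s - 1)) :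
    incl h (PresentedGroup.of i) = PresentedGroup.of ⟨i, by omega⟩ := by
  have : 1 ≤ (i : ℕ) + 1 ∧ (i : ℕ) + 1 < n := by omega
  simp only [incl, PresentedGroup.toGroup.of, sigma, this, and_self, dif_pos]
  rfl

theorem incl_sigma {s n : ℕ} (h : s ≤ n) {i : ℕ} (h1 : 1 ≤ i) (h2 : i < s) :
    incl h (sigma s i) = sigma n i := by
  have a : 1 ≤ i ∧ i < s := ⟨h1, h2⟩
  have b : 1 ≤ i ∧ i < n := ⟨h1, by omega⟩
  simp only [sigma, a, b, and_self, dif_pos, incl_of]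

theorem perm_incl {s n : ℕ} (h : s ≤ n) (b : Braid s) :
    perm n (incl h b) = (perm s b).viaFintypeEmbedding (Fin.castLEEmb h) := by
  have : (perm n).comp (incl h) =
      (Equiv.Perm.extendDomainHom (Fin.castLEEmb h).toEquivRange).comp (perm s) := by
    apply PresentedGroup.ext
    intro i
    simp only [MonoidHom.comp_apply, incl_of, perm, PresentedGroup.toGroup.of]
    ext x
    simp only [Equiv.Perm.extendDomainHom_apply, adjSwap]
    by_cases hx : (x : ℕ) < s
    · have e : x = ((Fin.castLEEmb h).toEquivRange ⟨x, hx⟩ : Fin n) := rfl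
      conv_rhs => rw [e, Equiv.Perm.extendDomain_apply_image]
      simp only [Equiv.swap_apply_def, Fin.ext_iff, Function.Embedding.toEquivRange_apply]
      simp only [Fin.castLEEmb_apply, Fin.val_castLE]
      split_ifs <;> rfl
    · rw [Equiv.Perm.extendDomain_apply_not_subtype]
      · rw [Equiv.swap_apply_of_ne_of_ne] <;>
          (intro h; rw [Fin.ext_iff] at h; simp at h; omega)
      · rintro ⟨y, rfl⟩
        exact hx y.2
  exact DFunLike.congr_fun this b

theorem incl_map_Pure {s n : ℕ} (h : s ≤ n) : (Pure s).map (incl h) ≤ Pure n := by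
  rintro _ ⟨b, hb, rfl⟩
  change perm n (incl h b) = 1
  have hb' : perm s b = 1 := hb
  rw [perm_incl, hb']
  exact map_one (Equiv.Perm.extendDomainHom (Fin.castLEEmb h).toEquivRange)

theorem lowerCentralSeries_mono {G : Type*} [Group G] {S T : Subgroup G} (h : S ≤ T) (k : ℕ) :
    S.lowerCentralSeries k ≤ T.lowerCentralSeries k := by
  induction k with
  | zero => simpa
  | succ k ih => exact Subgroup.commutator_mono ih h

theorem incl_Gam {s n : ℕ} (h : s ≤ n) (k : ℕ) : Gam k s ≤ (Gam k n).comap (incl h) := by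
  rw [← Subgroup.map_le_iff_le_comap, Gam, Subgroup.map_lowerCentralSeries]
  exact lowerCentralSeries_mono (incl_map_Pure h) _

/-- The homomorphism `B_s / Γ_3(P_s) → B_n / Γ_3(P_n)` induced by `incl`. -/
def inclQuot {s n : ℕ} (h : s ≤ n) : Quot3 s →* Quot3 n :=
  QuotientGroup.map _ _ (incl h) (incl_Gam h 3)

/-- The pure braid
`A_{i,j} = σ_{j-1} ⋯ σ_{i+1} σ_i² σ_{i+1}⁻¹ ⋯ σ_{j-1}⁻¹`, for `1 ≤ i < j ≤ n`. -/
def A (n i j : ℕ) : Braid n :=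
  ((List.Ico (i + 1) j).reverse.map (sigma n)).prod * sigma n i ^ 2 *
    (((List.Ico (i + 1) j).reverse.map (sigma n)).prod)⁻¹

/-- Triples `(i, j, k)` with `1 ≤ i < j < k ≤ n`. They are stored as elements of `Fin n`, so the
entry `i` is stored as `i - 1`. -/
abbrev Triple (n : ℕ) : Type :=
  {t : Fin n × Fin n × Fin n // t.1 < t.2.1 ∧ t.2.1 < t.2.2}

/-- `α_{i,j,k} = [A_{i,j}, A_{j,k}]`, where `[g, h] = g h g⁻¹ h⁻¹`, in `B_n / Γ_3(P_n)`. -/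
def alpha {n : ℕ} (t : Triple n) : Quot3 n :=
  QuotientGroup.mk
    ⁅A n (t.1.1 + 1) (t.1.2.1 + 1), A n (t.1.2.1 + 1) (t.1.2.2 + 1)⁆

theorem A_mem (n i j : ℕ) : A n i j ∈ Pure n := by
  change perm n (A n i j) = 1
  have : perm n (sigma n i) ^ 2 = 1 := by
    unfold sigma
    split_ifs with h
    · simp [perm, PresentedGroup.toGroup.of, adjSwap, pow_two]
    · simp
  simp [A, this]

theorem alpha_commute {n : ℕ} (t u : Triple n) : Commute (alpha t) (alpha u) := by
  have mem : ∀ t : Triple n, ⁅A n (t.1.1 + 1) (t.1.2.1 + 1), A n (t.1.2.1 + 1) (t.1.2.2 + 1)⁆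
      ∈ Gam 2 n := fun t => Subgroup.commutator_mem_commutator (A_mem _ _ _) (A_mem _ _ _)
  have le : Gam 2 n ≤ Pure n := (Pure n).lowerCentralSeries_antitone (Nat.zero_le 1)
  rw [← commutatorElement_eq_one_iff_commute]
  refine (QuotientGroup.eq_one_iff _).2 ?_
  exact Subgroup.commutator_mem_commutator (mem t) (le (mem u))

/-- The element `∏ α_{i,j,k} ^ r_{i,j,k}` of `Γ_2(P_n) / Γ_3(P_n)` with exponents `r`. -/
def theta {n : ℕ} (r : Triple n → ℤ) : Quot3 n :=
  Finset.univ.noncommProd (fun t => alpha t ^ r t)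
    (fun t _ u _ _ => (alpha_commute t u).zpow_zpow _ _)

/-- For odd `n`, the class in `B_n / Γ_3(P_n)` of
`δ_n = σ_{n-1} ⋯ σ_{(n+1)/2} σ_{(n-1)/2}⁻¹ ⋯ σ_1⁻¹`. -/
def delta (n : ℕ) : Quot3 n :=
  QuotientGroup.mk
    (((List.Ico ((n + 1) / 2) n).reverse.map (sigma n)).prod *
      ((List.Ico 1 ((n + 1) / 2)).reverse.map (fun i => (sigma n i)⁻¹)).prod)

open Classical in
/-- The triples `u` for which `α_u` lies in the orbit of `α_t` under conjugation by `δ_n`. -/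
noncomputable def orbit {n : ℕ} (t : Triple n) : Finset (Triple n) :=
  Finset.univ.filter fun u => ∃ l : ℤ, delta n ^ l * alpha t * (delta n ^ l)⁻¹ = alpha u

/-- The linear conditions on the exponents `r`, where `m` is the family of exponents of `δ_n ^ n`:
over each orbit the exponents `r` add up to the negative of the value of `m` on that orbit. -/
def Compatible {n : ℕ} (m r : Triple n → ℤ) : Prop :=
  ∀ t : Triple n, ∑ u ∈ orbit t, r u = -m t

end ArtinBraid

namespace ArtinBraid

open scoped commutatorElement

/-! ### Homomorphisms out of braid groups -/

/-! Modulo `Γ_3(P_n)` commutators of pure braids are bilinear, and conjugation by a braid permutes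
the classes of the `A_{i,j}` modulo `Γ_2(P_n)` through `S_n`. Since the `A_{i,j}` generate `P_n`
(`closureA_eq_Pure`), `Γ_2/Γ_3` is generated by their commutators. Those with disjoint indices
vanish, and those on three indices are, up to sign and cyclic rotation, the `α_{i,j,k}`
(`triA_rotate`). Hence every element is some `θ(r)` (`Gam2Quot_le_thetaRange`).

Independence needs an invariant. The braid group acts on the positions of three strands together
with a class-two nilpotent group `Linking`, which records the pairwise linking numbers and one
secondary integer. The action kills `Γ_3(P_n)`, and on the strands `i, j, k` it reads off `24
r_{i,j,k}` from `θ(r)`. It does not depend on the number of strings, so it also shows that the map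
induced by `B_s → B_n` is injective on the `θ(r)`.

For odd `s` the signs in `δ_s` make all linking numbers of `δ_s^s` vanish, so `δ_s^s` lies in
`Γ_2/Γ_3` and equals some `θ(μ)` (`delta_pow_mem`). Conjugation by `δ_s` rotates the indices
cyclically and so permutes the `α` by some `ρ`; as `δ_s` commutes with `δ_s^s`, `μ` is constant on
orbits. Each rotation lowers the index sum by 3 modulo `s`. As 3 is invertible there, every orbit
has exactly `s` elements, one for each residue (`sum_orbit`).

Collecting the powers of `δ_s` on the right turns `(θ(r) δ_s)^s` into `θ` of the orbit sums of `r`,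
times `θ(μ)`. This is trivial exactly under the stated linear conditions, and smaller positive
powers are excluded by the permutation (`orderOf_inclQuot`). Shifting weight between two elements of
each orbit gives infinitely many solutions. -/

theorem sigma_of {n : ℕ} (i : Fin (n - 1)) :
    sigma n (i + 1) = (PresentedGroup.of i : Braid n) := by
  have : 1 ≤ (i : ℕ) + 1 ∧ (i : ℕ) + 1 < n := by omega
  simp only [sigma, this, and_self, dif_pos]
  rfl

theorem of_eq_sigma {n i : ℕ} (h1 : 1 ≤ i) (h2 : i < n) :
    (PresentedGroup.of ⟨i - 1, by omega⟩ : Braid n) = sigma n i := by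
  rw [sigma, dif_pos ⟨h1, h2⟩]

/-- The homomorphism `B_n → G` with `σ_i ↦ g i`, for a family `g` subject to the Artin
relations. -/
def liftBraid {G : Type*} [Group G] (n : ℕ) (g : ℕ → G)
    (hc : ∀ i j, i + 2 ≤ j → g i * g j = g j * g i)
    (hb : ∀ i, g (i + 1) * g i * g (i + 1) = g i * g (i + 1) * g i) : Braid n →* G :=
  PresentedGroup.toGroup (f := fun i : Fin (n - 1) => g (i + 1)) (by
    rintro r (⟨i, j, hij, rfl⟩ | ⟨i, j, hij, rfl⟩)
    · simp only [map_mul, map_inv, FreeGroup.lift_apply_of, mul_inv_eq_one]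
      exact hc _ _ (by omega)
    · simp only [map_mul, map_inv, FreeGroup.lift_apply_of, mul_inv_eq_one]
      rw [← hij]
      exact hb _)

theorem liftBraid_sigma {G : Type*} [Group G] {n : ℕ} {g : ℕ → G} {hc hb} {i : ℕ}
    (h1 : 1 ≤ i) (h2 : i < n) : liftBraid n g hc hb (sigma n i) = g i := by
  rw [← of_eq_sigma h1 h2, liftBraid, PresentedGroup.toGroup.of]
  simp only
  congr 1
  omega

theorem braid_induction {n : ℕ} {p : Braid n → Prop} (g : Braid n) (one : p 1)
    (mul : ∀ x y, p x → p y → p (x * y)) (inv : ∀ x, p x → p x⁻¹)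
    (gen : ∀ i, 1 ≤ i → i < n → p (sigma n i)) : p g := by
  have h : g ∈ Subgroup.closure (Set.range (PresentedGroup.of : Fin (n - 1) → Braid n)) := by
    rw [PresentedGroup.closure_range_of]; trivial
  induction h using Subgroup.closure_induction with
  | mem x hx =>
    obtain ⟨i, rfl⟩ := hx
    rw [← sigma_of]
    exact gen _ (by omega) (by omega)
  | one => exact one
  | mul x y _ _ hx hy => exact mul x y hx hy
  | inv x _ hx => exact inv x hx

theorem sigma_comm {n i j : ℕ} (h : i + 2 ≤ j) : sigma n i * sigma n j = sigma n j * sigma n i := by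
  by_cases hi : 1 ≤ i ∧ i < n
  · by_cases hj : 1 ≤ j ∧ j < n
    · rw [← of_eq_sigma hi.1 hi.2, ← of_eq_sigma hj.1 hj.2, ← mul_inv_eq_one]
      exact PresentedGroup.one_of_mem (Or.inl ⟨⟨i - 1, by omega⟩, ⟨j - 1, by omega⟩,
        by simp only; omega, rfl⟩)
    · simp [sigma, hj]
  · simp [sigma, hi]

theorem sigma_braid {n i : ℕ} (h1 : 1 ≤ i) (h : i + 1 < n) :
    sigma n (i + 1) * sigma n i * sigma n (i + 1) = sigma n i * sigma n (i + 1) * sigma n i := by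
  rw [← of_eq_sigma (i := i) h1 (by omega), ← of_eq_sigma (i := i + 1) (by omega) h,
    ← mul_inv_eq_one]
  exact PresentedGroup.one_of_mem (Or.inr ⟨⟨i - 1, by omega⟩, ⟨i, by omega⟩,
    by simp only; omega, rfl⟩)

/-! ### The action on positions -/

theorem swap_comm_of_le {i j : ℕ} (h : i + 2 ≤ j) :
    Equiv.swap i (i + 1) * Equiv.swap j (j + 1) = Equiv.swap j (j + 1) * Equiv.swap i (i + 1) := by
  ext x
  simp only [Equiv.Perm.mul_apply, Equiv.swap_apply_def]
  grind

theorem swap_braid (i : ℕ) :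
    Equiv.swap (i + 1) (i + 2) * Equiv.swap i (i + 1) * Equiv.swap (i + 1) (i + 2) =
      Equiv.swap i (i + 1) * Equiv.swap (i + 1) (i + 2) * Equiv.swap i (i + 1) := by
  ext x
  simp only [Equiv.Perm.mul_apply, Equiv.swap_apply_def]
  grind

/-- The action of `B_n` on positions: `σ_i` exchanges `i` and `i + 1`. -/
def permNat (n : ℕ) : Braid n →* Equiv.Perm ℕ :=
  liftBraid n (fun i => Equiv.swap i (i + 1)) (fun _ _ h => swap_comm_of_le h) swap_braid

theorem permNat_sigma {n i : ℕ} (h1 : 1 ≤ i) (h2 : i < n) :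
    permNat n (sigma n i) = Equiv.swap i (i + 1) := liftBraid_sigma h1 h2

theorem permNat_perm {n : ℕ} (g : Braid n) (k : Fin n) :
    permNat n g (k + 1) = (perm n g k : ℕ) + 1 := by
  induction g using braid_induction generalizing k with
  | one => simp
  | mul x y hx hy =>
    rw [map_mul, map_mul, Equiv.Perm.mul_apply, Equiv.Perm.mul_apply, hy, hx]
  | inv x hx =>
    rw [map_inv, map_inv, Equiv.Perm.inv_eq_iff_eq, hx]
    simp
  | gen i h1 h2 =>
    rw [permNat_sigma h1 h2, ← of_eq_sigma h1 h2, perm, PresentedGroup.toGroup.of]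
    simp only [adjSwap, Equiv.swap_apply_def, Fin.ext_iff]
    grind

theorem permNat_of_not_mem {n : ℕ} (g : Braid n) (k : ℕ) (hk : k = 0 ∨ n < k) :
    permNat n g k = k := by
  induction g using braid_induction with
  | one => simp
  | mul x y hx hy => rw [map_mul, Equiv.Perm.mul_apply, hy, hx]
  | inv x hx => rw [map_inv, Equiv.Perm.inv_eq_iff_eq, hx]
  | gen i h1 h2 => rw [permNat_sigma h1 h2, Equiv.swap_apply_of_ne_of_ne] <;> omega

theorem permNat_eq_one_iff {n : ℕ} (g : Braid n) : permNat n g = 1 ↔ g ∈ Pure n := by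
  change _ ↔ perm n g = 1
  constructor
  · intro h
    ext k
    have := permNat_perm g k
    rw [h] at this
    simp only [Equiv.Perm.coe_one, id_eq] at this ⊢
    omega
  · intro h
    ext k
    by_cases hk : k = 0 ∨ n < k
    · exact permNat_of_not_mem g k hk
    · have := permNat_perm g ⟨k - 1, by omega⟩
      rw [h] at this
      simp only [Equiv.Perm.coe_one, id_eq] at this ⊢
      rwa [Nat.sub_add_cancel (by omega)] at this

theorem permNat_mem_iff {n : ℕ} (g : Braid n) (k : ℕ) :
    (1 ≤ permNat n g k ∧ permNat n g k ≤ n) ↔ (1 ≤ k ∧ k ≤ n) := by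
  constructor
  · intro h
    by_contra hk
    rw [permNat_of_not_mem g k (by omega)] at h
    exact hk h
  · intro h
    by_contra hk
    have h2 := permNat_of_not_mem g (permNat n g k) (by omega)
    rw [EmbeddingLike.apply_eq_iff_eq] at h2
    rw [h2] at hk
    exact hk h

/-! ### A nilpotent group recording linking numbers of three strands -/

/-- A nilpotent group of class two: `a`, `b`, `c` count crossings of the strands
`1, 2`, of `1, 3` and of `2, 3`. -/
@[ext] structure Linking where
  a : ℤ
  b : ℤ
  c : ℤ
  x : ℤ

namespace Linking

/-- The cocycle is 3 times the alternating form given, up to sign, by the determinant with first row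
`(1, 1, 1)`. Thus `(1, 1, 1)`, the direction of the full twist on three strands, is central. The
factor 3 balances the three corrections `±1` of `crossing` in the braid relation. -/
instance : Mul Linking where
  mul u v := ⟨u.a + v.a, u.b + v.b, u.c + v.c, u.x + v.x +
    3 * (u.a * v.c - u.c * v.a + u.c * v.b - u.b * v.c + u.b * v.a - u.a * v.b)⟩

instance : One Linking := ⟨⟨0, 0, 0, 0⟩⟩

instance : Inv Linking := ⟨fun u => ⟨-u.a, -u.b, -u.c, -u.x⟩⟩

theorem mul_def (u v : Linking) : u * v = ⟨u.a + v.a, u.b + v.b, u.c + v.c, u.x + v.x +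
    3 * (u.a * v.c - u.c * v.a + u.c * v.b - u.b * v.c + u.b * v.a - u.a * v.b)⟩ := rfl

theorem one_def : (1 : Linking) = ⟨0, 0, 0, 0⟩ := rfl

theorem inv_def (u : Linking) : u⁻¹ = ⟨-u.a, -u.b, -u.c, -u.x⟩ := rfl

instance : Group Linking := Group.ofLeftAxioms
  (fun u v w => by simp only [mul_def, mk.injEq]; refine ⟨?_, ?_, ?_, ?_⟩ <;> ring)
  (fun u => by simp [mul_def, one_def])
  (fun u => by simp only [mul_def, inv_def, one_def, mk.injEq]; refine ⟨?_, ?_, ?_, ?_⟩ <;> ring)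

theorem commutator_def (u v : Linking) : ⁅u, v⁆ = ⟨0, 0, 0,
    6 * (u.a * v.c - u.c * v.a + u.c * v.b - u.b * v.c + u.b * v.a - u.a * v.b)⟩ := by
  simp only [commutatorElement_def, mul_def, inv_def, mk.injEq]
  refine ⟨?_, ?_, ?_, ?_⟩ <;> ring

end Linking

/-- `1` if `p` and `q` are `i` and `i + 1` in some order, else `0`. -/
def meets (i p q : ℕ) : ℤ :=
  if (p = i ∧ q = i + 1) ∨ (p = i + 1 ∧ q = i) then 1 else 0

/-- `1` if `p < q`, `-1` if `q < p`, and `0` if `p = q`. -/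
def side (p q : ℕ) : ℤ := if p < q then 1 else if q < p then -1 else 0

/-- The contribution of a crossing of the positions `i` and `i + 1`, if the strands `1, 2, 3` are
at the positions `p`, `q`, `r`. -/
def crossing (i p q r : ℕ) : Linking :=
  ⟨meets i p q, meets i p r, meets i q r,
    -- Linking numbers alone cannot distinguish the order of crossings; this correction by the side
    -- on which the third strand lies makes the two words of the braid relation agree in `x`.
    -(meets i p q * side p q * side p r) + meets i p r * side p r * side p q -
      meets i q r * side q r * side q p⟩

-- Each strand is at `i`, `i + 1`, `i + 2`, below or above, and only this matters, which leaves 125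
-- cases. In the case `p, q, r = i, i + 1, i + 2`, the corrections add up to 3 on the left and -3 on
-- the right, and the form contributes -3 and 3.
set_option maxHeartbeats 2000000 in
theorem crossing_braid (i p q r : ℕ) :
    let s := Equiv.swap i (i + 1)
    let t := Equiv.swap (i + 1) (i + 2)
    crossing (i + 1) (s (t p)) (s (t q)) (s (t r)) *
        (crossing i (t p) (t q) (t r) * crossing (i + 1) p q r) =
      crossing i (t (s p)) (t (s q)) (t (s r)) *
        (crossing (i + 1) (s p) (s q) (s r) * crossing i p q r) := by
  intro s t
  have hs0 : s i = i + 1 := Equiv.swap_apply_left _ _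
  have hs1 : s (i + 1) = i := Equiv.swap_apply_right _ _
  have hs2 : s (i + 2) = i + 2 := Equiv.swap_apply_of_ne_of_ne (by omega) (by omega)
  have ht0 : t i = i := Equiv.swap_apply_of_ne_of_ne (by omega) (by omega)
  have ht1 : t (i + 1) = i + 2 := Equiv.swap_apply_left _ _
  have ht2 : t (i + 2) = i + 1 := Equiv.swap_apply_right _ _
  have key : ∀ x, x = i ∨ x = i + 1 ∨ x = i + 2 ∨
      (s x = x ∧ t x = x ∧ x ≠ i ∧ x ≠ i + 1 ∧ x ≠ i + 2 ∧ ¬ i < x ∧ ¬ i + 1 < x ∧ ¬ i + 2 < x ∧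
        x < i ∧ x < i + 1 ∧ x < i + 2) ∨
      (s x = x ∧ t x = x ∧ x ≠ i ∧ x ≠ i + 1 ∧ x ≠ i + 2 ∧ i < x ∧ i + 1 < x ∧ i + 2 < x ∧
        ¬ x < i ∧ ¬ x < i + 1 ∧ ¬ x < i + 2) := by
    intro x
    have hs : x ≠ i → x ≠ i + 1 → s x = x := Equiv.swap_apply_of_ne_of_ne
    have ht : x ≠ i + 1 → x ≠ i + 2 → t x = x := Equiv.swap_apply_of_ne_of_ne
    by_cases h0 : x = i
    · simp [h0]
    by_cases h1 : x = i + 1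
    · simp [h1]
    by_cases h2 : x = i + 2
    · simp [h2]
    rw [hs h0 h1, ht h1 h2]
    omega
  have h2 : i + 1 + 1 = i + 2 := rfl
  have h3 : i ≠ i + 2 := by omega
  clear_value s t
  rcases key p with hp | hp | hp | hp | hp <;>
  rcases key q with hq | hq | hq | hq | hq <;>
  rcases key r with hr | hr | hr | hr | hr <;>
  clear key <;>
  simp [*, Linking.mul_def, crossing, meets, side]

theorem meets_swap {i j : ℕ} (h : i + 2 ≤ j ∨ j + 2 ≤ i) (p q : ℕ) :
    meets i (Equiv.swap j (j + 1) p) (Equiv.swap j (j + 1) q) = meets i p q := by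
  simp only [meets, Equiv.swap_apply_def]
  grind

theorem meets_side_swap {i j : ℕ} (h : i + 2 ≤ j ∨ j + 2 ≤ i) (p q r : ℕ) :
    meets i (Equiv.swap j (j + 1) p) (Equiv.swap j (j + 1) q) *
        side (Equiv.swap j (j + 1) p) (Equiv.swap j (j + 1) q) *
        side (Equiv.swap j (j + 1) p) (Equiv.swap j (j + 1) r) =
      meets i p q * side p q * side p r := by
  rw [meets_swap h]
  by_cases hm : (p = i ∧ q = i + 1) ∨ (p = i + 1 ∧ q = i)
  · have hp : Equiv.swap j (j + 1) p = p :=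
      Equiv.swap_apply_of_ne_of_ne (by omega) (by omega)
    have hq : Equiv.swap j (j + 1) q = q :=
      Equiv.swap_apply_of_ne_of_ne (by omega) (by omega)
    rw [hp, hq]
    congr 1
    simp only [side, Equiv.swap_apply_def]
    grind
  · simp [meets, hm]

theorem meets_comm (i p q : ℕ) : meets i p q = meets i q p := by
  simp only [meets]; grind

theorem crossing_swap {i j : ℕ} (h : i + 2 ≤ j ∨ j + 2 ≤ i) (p q r : ℕ) :
    crossing i (Equiv.swap j (j + 1) p) (Equiv.swap j (j + 1) q) (Equiv.swap j (j + 1) r) =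
      crossing i p q r := by
  simp only [crossing, meets_swap h, Linking.mk.injEq, true_and]
  have h1 := meets_side_swap h p q r
  have h2 := meets_side_swap h p r q
  have h3 := meets_side_swap h q r p
  rw [meets_swap h] at h1 h2 h3
  rw [h1, h2, h3]

/-- Distant crossings share no strand, so every product of entries of the alternating form vanishes.
-/
theorem crossing_commute {i j : ℕ} (h : i + 2 ≤ j) (p q r : ℕ) :
    crossing i p q r * crossing j p q r = crossing j p q r * crossing i p q r := by
  have key : ∀ p q r, meets i p q * meets j q r = 0 := by
    intro p q r
    simp only [meets]
    split_ifs <;> omega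
  have e1 := key p q r
  have e2 := key q p r
  have e3 := key r q p
  have e4 := key p r q
  have e5 := key q r p
  have e6 := key r p q
  rw [meets_comm i q p] at e2
  rw [meets_comm i r q, meets_comm j q p] at e3
  rw [meets_comm j r q] at e4
  rw [meets_comm j r p] at e5
  rw [meets_comm i r p] at e6
  simp only [crossing, Linking.mul_def, Linking.mk.injEq]
  refine ⟨add_comm _ _, add_comm _ _, add_comm _ _, ?_⟩
  linear_combination 6 * (e1 - e3 + e5 - e4 + e6 - e2)

/-! ### The action of braids on positions and linking numbers of three strands -/

/-- The action of a crossing on the positions of three strands and their linking data. -/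
def linkingStep (i : ℕ) : Equiv.Perm ((ℕ × ℕ × ℕ) × Linking) :=
  Equiv.prodShear ((Equiv.swap i (i + 1)).prodCongr
      ((Equiv.swap i (i + 1)).prodCongr (Equiv.swap i (i + 1))))
    (fun t => Equiv.mulLeft (crossing i t.1 t.2.1 t.2.2))

theorem linkingStep_apply (i p q r : ℕ) (x : Linking) :
    linkingStep i ((p, q, r), x) =
      ((Equiv.swap i (i + 1) p, Equiv.swap i (i + 1) q, Equiv.swap i (i + 1) r),
        crossing i p q r * x) := rfl

/-- The action of `B_n` on the positions of three strands and their linking data. -/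
def linkingAction (n : ℕ) : Braid n →* Equiv.Perm ((ℕ × ℕ × ℕ) × Linking) :=
  liftBraid n linkingStep
    (by
      intro i j h
      ext1 ⟨⟨p, q, r⟩, x⟩
      simp only [Equiv.Perm.mul_apply, linkingStep_apply, ← mul_assoc]
      have hs := fun x => DFunLike.congr_fun (swap_comm_of_le h) x
      simp only [Equiv.Perm.mul_apply] at hs
      rw [crossing_swap (Or.inl h), crossing_swap (Or.inr h), crossing_commute h, hs, hs, hs])
    (by
      intro i
      ext1 ⟨⟨p, q, r⟩, x⟩
      have hs := fun x => DFunLike.congr_fun (swap_braid i) x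
      simp only [Equiv.Perm.mul_apply] at hs
      simp only [Equiv.Perm.mul_apply, linkingStep_apply, ← mul_assoc]
      rw [hs, hs, hs]
      have := crossing_braid i p q r
      simp only [← mul_assoc] at this
      rw [this])

theorem linkingAction_sigma {n i : ℕ} (h1 : 1 ≤ i) (h2 : i < n) :
    linkingAction n (sigma n i) = linkingStep i := liftBraid_sigma h1 h2

/-- The linking data that a braid adds to three strands at given positions. -/
def linking {n : ℕ} (g : Braid n) (p q r : ℕ) : Linking := (linkingAction n g ((p, q, r), 1)).2

/-- Braids act on the second factor by left multiplications, so the value at 1 determines everything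
and `linking` is a cocycle over the action on positions. -/
theorem linkingAction_apply {n : ℕ} (g : Braid n) (p q r : ℕ) (x : Linking) :
    linkingAction n g ((p, q, r), x) =
      ((permNat n g p, permNat n g q, permNat n g r), linking g p q r * x) := by
  induction g using braid_induction generalizing p q r x with
  | one => simp [linking]
  | mul g h hg hh =>
    have key : ∀ x, linkingAction n (g * h) ((p, q, r), x) = _ := fun x => by
      rw [map_mul, Equiv.Perm.mul_apply, hh, hg]
    have h1 : linking (g * h) p q r = _ := congrArg Prod.snd (key 1)
    rw [key, h1, map_mul]
    simp [mul_assoc]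
  | inv g hg =>
    have key : ∀ p q r y, (linkingAction n g)⁻¹ ((p, q, r), y) =
        (((permNat n g)⁻¹ p, (permNat n g)⁻¹ q, (permNat n g)⁻¹ r),
          (linking g ((permNat n g)⁻¹ p) ((permNat n g)⁻¹ q) ((permNat n g)⁻¹ r))⁻¹ * y) := by
      intro p q r y
      rw [Equiv.Perm.inv_eq_iff_eq, hg]
      simp
    have h1 : linking g⁻¹ p q r = _ := congrArg Prod.snd
      ((congrArg (fun f => f ((p, q, r), 1)) (map_inv (linkingAction n) g)).trans (key p q r 1))
    rw [h1, map_inv, key, map_inv, mul_one]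
  | gen i h1 h2 =>
    simp [linking, linkingAction_sigma h1 h2, linkingStep_apply, permNat_sigma h1 h2]

theorem linking_one {n : ℕ} (p q r : ℕ) : linking (1 : Braid n) p q r = 1 := by
  simp [linking]

theorem linking_mul {n : ℕ} (g h : Braid n) (p q r : ℕ) :
    linking (g * h) p q r =
      linking g (permNat n h p) (permNat n h q) (permNat n h r) * linking h p q r := by
  change (linkingAction n (g * h) ((p, q, r), 1)).2 = _
  rw [map_mul, Equiv.Perm.mul_apply, linkingAction_apply, linkingAction_apply, mul_one]

theorem linking_sigma {n i : ℕ} (h1 : 1 ≤ i) (h2 : i < n) (p q r : ℕ) :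
    linking (sigma n i) p q r = crossing i p q r := by
  simp [linking, linkingAction_sigma h1 h2, linkingStep_apply]

theorem permNat_of_mem {n : ℕ} {g : Braid n} (hg : g ∈ Pure n) (p : ℕ) : permNat n g p = p := by
  rw [(permNat_eq_one_iff g).2 hg]; rfl

/-- On pure braids, the linking data is a homomorphism. -/
def pureLinking (n p q r : ℕ) : Pure n →* Linking where
  toFun g := linking (g : Braid n) p q r
  map_one' := linking_one p q r
  map_mul' g h := by
    simp only [Subgroup.coe_mul, linking_mul, permNat_of_mem h.2]

theorem linking_inv {n : ℕ} {g : Braid n} (hg : g ∈ Pure n) (p q r : ℕ) :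
    linking g⁻¹ p q r = (linking g p q r)⁻¹ :=
  map_inv (pureLinking n p q r) ⟨g, hg⟩

theorem linking_commutator {n : ℕ} {g h : Braid n} (hg : g ∈ Pure n) (hh : h ∈ Pure n)
    (p q r : ℕ) : linking ⁅g, h⁆ p q r = ⁅linking g p q r, linking h p q r⁆ :=
  map_commutatorElement (pureLinking n p q r) ⟨g, hg⟩ ⟨h, hh⟩

theorem Gam_two_le (n : ℕ) : Gam 2 n ≤ Pure n :=
  (Pure n).lowerCentralSeries_antitone (Nat.zero_le 1)

theorem Gam_two_eq (n : ℕ) : Gam 2 n = ⁅Pure n, Pure n⁆ := rfl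

theorem Gam_three_eq (n : ℕ) : Gam 3 n = ⁅Gam 2 n, Pure n⁆ := rfl

theorem linking_of_mem_Gam_two {n : ℕ} {g : Braid n} (hg : g ∈ Gam 2 n) (p q r : ℕ) :
    linking g p q r = ⟨0, 0, 0, (linking g p q r).x⟩ := by
  rw [Gam_two_eq, Subgroup.commutator_def] at hg
  have hP : Subgroup.closure {g | ∃ g₁ ∈ Pure n, ∃ g₂ ∈ Pure n, ⁅g₁, g₂⁆ = g} ≤ Pure n :=
    Gam_two_le n
  induction hg using Subgroup.closure_induction with
  | mem x hx =>
    obtain ⟨g, hg, h, hh, rfl⟩ := hx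
    rw [linking_commutator hg hh, Linking.commutator_def]
  | one => rw [linking_one]; rfl
  | mul x y hx hy ihx ihy =>
    rw [linking_mul, permNat_of_mem (hP hy), permNat_of_mem (hP hy), permNat_of_mem (hP hy), ihx,
      ihy]
    simp [Linking.mul_def]
  | inv x hx ih =>
    rw [linking_inv (hP hx), ih]
    simp [Linking.inv_def]

/-- On `Γ_2(P_n)` the linking data lies in the centre of `Linking`, so a further commutator with a
pure braid becomes trivial. -/
theorem Gam_three_le_ker (n : ℕ) : Gam 3 n ≤ (linkingAction n).ker := by
  rw [Gam_three_eq, Subgroup.commutator_le]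
  intro g hg h hh
  have hg' := Gam_two_le n hg
  rw [MonoidHom.mem_ker]
  ext1 ⟨⟨p, q, r⟩, x⟩
  have hm : ⁅g, h⁆ ∈ Pure n := Gam_two_le n (Subgroup.commutator_mem_commutator hg' hh)
  have h1 : ⁅linking g p q r, linking h p q r⁆ = 1 := by
    rw [linking_of_mem_Gam_two hg, Linking.commutator_def]
    simp [Linking.one_def]
  rw [linkingAction_apply, linking_commutator hg' hh, h1, permNat_of_mem hm,
    permNat_of_mem hm, permNat_of_mem hm]
  simp

/-- The action of `B_n / Γ_3(P_n)` on positions and linking data. -/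
def linkingQuot (n : ℕ) : Quot3 n →* Equiv.Perm ((ℕ × ℕ × ℕ) × Linking) :=
  QuotientGroup.lift _ (linkingAction n) (Gam_three_le_ker n)

/-- The action is on positions in all of `ℕ`, so extra strings change nothing; invariants of `B_s`
can therefore be read in `B_n`. -/
theorem linkingAction_incl {s n : ℕ} (h : s ≤ n) (g : Braid s) :
    linkingAction n (incl h g) = linkingAction s g := by
  have : (linkingAction n).comp (incl h) = linkingAction s := by
    apply PresentedGroup.ext
    intro i
    rw [← sigma_of, MonoidHom.comp_apply, incl_sigma h (by omega) (by omega),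
      linkingAction_sigma (by omega) (by omega), linkingAction_sigma (by omega) (by omega)]
  exact DFunLike.congr_fun this g

theorem linkingQuot_inclQuot {s n : ℕ} (h : s ≤ n) (g : Quot3 s) :
    linkingQuot n (inclQuot h g) = linkingQuot s g := by
  obtain ⟨g, rfl⟩ := QuotientGroup.mk_surjective g
  exact linkingAction_incl h g

/-! ### Conjugation of the pure braid generators -/

theorem A_self (n i : ℕ) : A n i (i + 1) = sigma n i ^ 2 := by simp [A]

theorem A_succ (n : ℕ) {i j : ℕ} (h : i < j) :
    A n i (j + 1) = sigma n j * A n i j * (sigma n j)⁻¹ := by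
  simp [A, List.Ico.succ_top (show i + 1 ≤ j from h), mul_assoc]

theorem sigma_commute_A {n k i j : ℕ} (hij : i < j) (hk : j < k ∨ k + 1 < i) :
    Commute (sigma n k) (A n i j) := by
  have comm : ∀ l, l < j → i ≤ l → Commute (sigma n k) (sigma n l) := by
    intro l h1 h2
    rcases hk with hk | hk
    · exact (sigma_comm (by omega)).symm
    · exact sigma_comm (by omega)
  induction j, hij using Nat.le_induction with
  | base => rw [A_self]; exact (comm i (by omega) le_rfl).pow_right 2
  | succ j hij ih =>
    rw [A_succ n hij]
    have hc := comm j (by omega) (by omega)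
    exact (hc.mul_right (ih (by omega) (fun l h1 h2 => comm l (by omega) h2))).mul_right
      hc.inv_right

/-- With `a = σ_k` and `b = σ_{k+1}`, the braid `A_{i,k+2}` is the conjugate of `A_{i,k}` by `b a`.
The relation `a (b a) = (b a) b` turns `a` into `b`, which commutes with `A_{i,k}`. -/
theorem sigma_commute_A_of_between {n k i j : ℕ} (hi : i < k) (hj : k + 2 ≤ j) (hn : j ≤ n) :
    Commute (sigma n k) (A n i j) := by
  induction j, hj using Nat.le_induction with
  | base =>
    rw [A_succ n (show i < k + 1 by omega), A_succ n hi]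
    have hb := sigma_braid (n := n) (i := k) (by omega) (by omega)
    have hc : sigma n (k + 1) * A n i k = A n i k * sigma n (k + 1) :=
      sigma_commute_A hi (Or.inl (by omega))
    generalize sigma n k = a at *
    generalize sigma n (k + 1) = b at *
    generalize A n i k = c at *
    have hc' : Commute b c := hc
    have e : b * (a * c * a⁻¹) * b⁻¹ = (b * a) * c * (b * a)⁻¹ := by group
    rw [e]
    have e1 : a * (b * a) = (b * a) * b := by rw [← mul_assoc, hb]
    have e2 : (b * a)⁻¹ * a = b * (b * a)⁻¹ := by
      rw [inv_mul_eq_iff_eq_mul, ← mul_assoc, ← e1, mul_assoc, mul_inv_cancel, mul_one]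
    change a * (b * a * c * (b * a)⁻¹) = b * a * c * (b * a)⁻¹ * a
    rw [mul_assoc _ _ a, e2, ← mul_assoc, ← mul_assoc, e1, mul_assoc (b * a), hc]
    simp only [mul_assoc]
  | succ j hj ih =>
    rw [A_succ n (show i < j by omega)]
    have hc : Commute (sigma n k) (sigma n j) := sigma_comm (by omega)
    exact (hc.mul_right (ih (by omega))).mul_right hc.inv_right

theorem sigma_conj_A_left {n i j : ℕ} (hi : 1 ≤ i) (hj : i + 2 ≤ j) (hn : j ≤ n) :
    sigma n i * A n i j * (sigma n i)⁻¹ = A n (i + 1) j := by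
  induction j, hj using Nat.le_induction with
  | base =>
    rw [A_succ n (show i < i + 1 by omega), A_self, A_self]
    have hb := sigma_braid (n := n) (i := i) (by omega) (by omega)
    generalize sigma n i = a at *
    generalize sigma n (i + 1) = b at *
    have e : a * (b * a ^ 2 * b⁻¹) * a⁻¹ = (a * b * a) * a * (a * b)⁻¹ := by
      rw [pow_two]; group
    rw [e, ← hb]
    have e2 : b * a * b * a * (a * b)⁻¹ = b * (a * b * a) * (a * b)⁻¹ := by group
    rw [e2, ← hb, pow_two]
    group
  | succ j hj ih =>
    rw [A_succ n (show i < j by omega), A_succ n (show i + 1 < j by omega), ← ih (by omega)]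
    have hc : sigma n i * sigma n j = sigma n j * sigma n i := sigma_comm (by omega)
    generalize sigma n i = a at *
    generalize sigma n j = b at *
    rw [show a * (b * A n i j * b⁻¹) * a⁻¹ = (a * b) * A n i j * (a * b)⁻¹ by group, hc]
    group

/-- The pure braid `A_{i,j}` attached to two positions in either order. -/
def pairA (n i j : ℕ) : Braid n := A n (min i j) (max i j)

theorem pairA_comm (n i j : ℕ) : pairA n i j = pairA n j i := by
  rw [pairA, pairA, min_comm, max_comm]

theorem pairA_of_lt (n : ℕ) {i j : ℕ} (h : i < j) : pairA n i j = A n i j := by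
  rw [pairA, min_eq_left h.le, max_eq_right h.le]

/-- The subgroup of `B_n` generated by the pure braids `A_{i,j}`. -/
def closureA (n : ℕ) : Subgroup (Braid n) :=
  Subgroup.closure {g | ∃ i j, 1 ≤ i ∧ i < j ∧ j ≤ n ∧ g = A n i j}

theorem A_mem_closureA {n i j : ℕ} (hi : 1 ≤ i) (hij : i < j) (hj : j ≤ n) :
    A n i j ∈ closureA n := Subgroup.subset_closure ⟨i, j, hi, hij, hj, rfl⟩

theorem sq_sigma_mem_closureA (n i : ℕ) : sigma n i ^ 2 ∈ closureA n := by
  by_cases h : 1 ≤ i ∧ i < n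
  · rw [← A_self]
    exact A_mem_closureA h.1 (by omega) h.2
  · simp [sigma, h]

theorem sigma_conj_A {n k i j : ℕ} (hk : 1 ≤ k) (hi : 1 ≤ i) (hij : i < j)
    (hj : j ≤ n) : ∃ h ∈ closureA n, sigma n k * A n i j * (sigma n k)⁻¹ =
      h * pairA n (Equiv.swap k (k + 1) i) (Equiv.swap k (k + 1) j) * h⁻¹ := by
  have fixed : k ≠ i → k + 1 ≠ i → k ≠ j → k + 1 ≠ j → Commute (sigma n k) (A n i j) →
      sigma n k * A n i j * (sigma n k)⁻¹ =
        1 * pairA n (Equiv.swap k (k + 1) i) (Equiv.swap k (k + 1) j) * 1⁻¹ := by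
    intro h1 h2 h3 h4 hc
    rw [Equiv.swap_apply_of_ne_of_ne h1.symm h2.symm, Equiv.swap_apply_of_ne_of_ne h3.symm h4.symm,
      pairA_of_lt n hij, hc.eq]
    group
  by_cases h1 : j < k ∨ k + 1 < i
  · exact ⟨1, one_mem _, fixed (by omega) (by omega) (by omega) (by omega)
      (sigma_commute_A hij h1)⟩
  by_cases h2 : i < k ∧ k + 1 < j
  · exact ⟨1, one_mem _, fixed (by omega) (by omega) (by omega) (by omega)
      (sigma_commute_A_of_between h2.1 h2.2 hj)⟩
  by_cases h3 : k = i
  · subst h3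
    by_cases h4 : j = k + 1
    · subst h4
      refine ⟨1, one_mem _, ?_⟩
      rw [Equiv.swap_apply_left, Equiv.swap_apply_right, pairA_comm, pairA_of_lt n hij, A_self]
      group
    · refine ⟨1, one_mem _, ?_⟩
      rw [Equiv.swap_apply_left, Equiv.swap_apply_of_ne_of_ne (by omega) h4,
        pairA_of_lt n (by omega), sigma_conj_A_left hk (by omega) hj]
      group
  by_cases h4 : k = j
  · subst h4
    refine ⟨1, one_mem _, ?_⟩
    rw [Equiv.swap_apply_left, Equiv.swap_apply_of_ne_of_ne (by omega) (by omega),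
        pairA_of_lt n (by omega), A_succ n hij]
    group
  -- In the two remaining cases `σ_k⁻¹` would give the swapped generator exactly; using `σ_k`
  -- instead costs a conjugation by `σ_k²`.
  by_cases h5 : k + 1 = j
  · subst h5
    refine ⟨_, sq_sigma_mem_closureA n k, ?_⟩
    rw [Equiv.swap_apply_right, Equiv.swap_apply_of_ne_of_ne (by omega) (by omega),
        pairA_of_lt n (by omega), A_succ n (by omega), pow_two]
    group
  have h6 : i = k + 1 := by omega
  subst h6
  refine ⟨_, sq_sigma_mem_closureA n k, ?_⟩
  rw [Equiv.swap_apply_right, Equiv.swap_apply_of_ne_of_ne (by omega) (by omega),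
        pairA_of_lt n (by omega), ← sigma_conj_A_left hk (by omega) hj, pow_two]
  group

theorem pairA_mem_closureA {n i j : ℕ} (hi : 1 ≤ i) (hj : 1 ≤ j) (hin : i ≤ n) (hjn : j ≤ n)
    (hij : i ≠ j) : pairA n i j ∈ closureA n :=
  A_mem_closureA (by omega) (by omega) (by omega)

theorem sigma_conj_closureA {n k : ℕ} (hk : 1 ≤ k) (hkn : k < n) {h : Braid n}
    (hh : h ∈ closureA n) : sigma n k * h * (sigma n k)⁻¹ ∈ closureA n := by
  suffices closureA n ≤ (closureA n).comap (MulAut.conj (sigma n k)).toMonoidHom from this hh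
  rw [closureA, Subgroup.closure_le]
  rintro _ ⟨i, j, hi, hij, hj, rfl⟩
  obtain ⟨h, hh, e⟩ := sigma_conj_A hk hi hij hj
  change sigma n k * A n i j * (sigma n k)⁻¹ ∈ closureA n
  rw [e]
  have hm : ∀ x, 1 ≤ x → x ≤ n → 1 ≤ Equiv.swap k (k + 1) x ∧ Equiv.swap k (k + 1) x ≤ n := by
    intro x h1 h2
    rw [Equiv.swap_apply_def]
    split_ifs <;> omega
  refine mul_mem (mul_mem hh (pairA_mem_closureA (hm i hi (by omega)).1 (hm j (by omega) hj).1
    (hm i hi (by omega)).2 (hm j (by omega) hj).2 ?_)) (inv_mem hh)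
  rw [Ne, EmbeddingLike.apply_eq_iff_eq]
  omega

instance (n : ℕ) : (closureA n).Normal := by
  suffices ∀ g : Braid n, ∀ h ∈ closureA n, g * h * g⁻¹ ∈ closureA n ∧ g⁻¹ * h * g ∈ closureA n from
    ⟨fun h hh g => (this g h hh).1⟩
  intro g
  induction g using braid_induction with
  | one => simp
  | mul x y hx hy =>
    intro h hh
    rw [show x * y * h * (x * y)⁻¹ = x * (y * h * y⁻¹) * x⁻¹ by group,
      show (x * y)⁻¹ * h * (x * y) = y⁻¹ * (x⁻¹ * h * x) * y by group]
    exact ⟨(hx _ (hy h hh).1).1, (hy _ (hx h hh).2).2⟩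
  | inv x hx =>
    intro h hh
    rw [inv_inv]
    exact (hx h hh).symm
  | gen k h1 h2 =>
    intro h hh
    have := sigma_conj_closureA h1 h2 hh
    refine ⟨this, ?_⟩
    -- Conjugation by `σ_k⁻¹` reduces to conjugation by `σ_k`, because `σ_k²` lies in the subgroup.
    rw [show (sigma n k)⁻¹ * h * sigma n k = (sigma n k ^ 2)⁻¹ *
      (sigma n k * h * (sigma n k)⁻¹) * sigma n k ^ 2 by group]
    have hs := sq_sigma_mem_closureA n k
    exact mul_mem (mul_mem (inv_mem hs) this) hs

/-! ### The Coxeter presentation of the symmetric group -/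

/-- The product `s j * s (j + 1) * ⋯` with `d` factors. -/
def ascending {W : Type*} [Group W] (s : ℕ → W) : ℕ → ℕ → W
  | _, 0 => 1
  | j, d + 1 => s j * ascending s (j + 1) d

theorem commute_ascending {W : Type*} [Group W] {s : ℕ → W}
    (hc : ∀ i j, i + 2 ≤ j → s i * s j = s j * s i) {k j d : ℕ} (h : k + 2 ≤ j) :
    s k * ascending s j d = ascending s j d * s k := by
  induction d generalizing j with
  | zero => simp [ascending]
  | succ d ih =>
    rw [ascending, ← mul_assoc, hc k j h, mul_assoc, ih (by omega), mul_assoc]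

theorem mul_ascending {W : Type*} [Group W] {n : ℕ} {s : ℕ → W}
    (hc : ∀ i j, i + 2 ≤ j → s i * s j = s j * s i)
    (hb : ∀ i, 1 ≤ i → i + 1 < n → s (i + 1) * s i * s (i + 1) = s i * s (i + 1) * s i)
    {k j d : ℕ} (hj : 1 ≤ j) (hk : j ≤ k) (hkd : k + 1 < j + d) (hd : j + d ≤ n) :
    s (k + 1) * ascending s j d = ascending s j d * s k := by
  induction d generalizing j with
  | zero => omega
  | succ d ih =>
    by_cases h : j = k
    · subst h
      obtain ⟨e, rfl⟩ : ∃ e, d = e + 1 := ⟨d - 1, by omega⟩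
      simp only [ascending]
      rw [mul_assoc (s j), mul_assoc (s (j + 1)), ← commute_ascending hc (by omega)]
      simp only [← mul_assoc]
      rw [hb j hj (by omega)]
    · rw [ascending, ← mul_assoc, ← hc j (k + 1) (by omega), mul_assoc,
        ih (by omega) (by omega) (by omega) (by omega), mul_assoc]

/-- Coxeter normal form: an element generated by `s_1, …, s_m` is `s_j ⋯ s_m` times one generated by
`s_1, …, s_{m-1}`. Its permutation sends `m + 1` to `j`, so a trivial permutation forces the first
factor to be empty, and induction applies to the second. -/
theorem eq_one_of_mem_closure_of_perm_eq_one {W : Type*} [Group W] {n : ℕ} {s : ℕ → W}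
    {ψ : W →* Equiv.Perm ℕ} (hs : ∀ i, s i * s i = 1)
    (hc : ∀ i j, i + 2 ≤ j → s i * s j = s j * s i)
    (hb : ∀ i, 1 ≤ i → i + 1 < n → s (i + 1) * s i * s (i + 1) = s i * s (i + 1) * s i)
    (hψ : ∀ i, 1 ≤ i → i < n → ψ (s i) = Equiv.swap i (i + 1)) {m : ℕ} (hm : m ≤ n) {x : W}
    (hx : x ∈ Subgroup.closure (s '' Set.Ico 1 m)) (h1 : ψ x = 1) : x = 1 := by
  induction m generalizing x with
  | zero => simpa using hx
  | succ m ih =>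
    have hinv : ∀ k, (s k)⁻¹ = s k := fun k => inv_eq_of_mul_eq_one_left (hs k)
    have step : ∀ k, k ∈ Set.Ico 1 (m + 1) → ∀ z, (∃ j d, 1 ≤ j ∧ j + d = m + 1 ∧
        ∃ y ∈ Subgroup.closure (s '' Set.Ico 1 m), z = ascending s j d * y) →
        ∃ j d, 1 ≤ j ∧ j + d = m + 1 ∧
        ∃ y ∈ Subgroup.closure (s '' Set.Ico 1 m), s k * z = ascending s j d * y := by
      rintro k ⟨hk1, hk2⟩ _ ⟨j, d, hj, hd, y, hy, rfl⟩
      have hsm : ∀ l, 1 ≤ l → l < m → s l ∈ Subgroup.closure (s '' Set.Ico 1 m) :=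
        fun l h1 h2 => Subgroup.subset_closure ⟨l, ⟨h1, h2⟩, rfl⟩
      rcases lt_trichotomy k j with h | rfl | h
      · by_cases h' : k + 1 = j
        · subst h'
          exact ⟨k, d + 1, hk1, by omega, y, hy, by rw [ascending, mul_assoc]⟩
        · refine ⟨j, d, hj, hd, s k * y, mul_mem (hsm k hk1 (by omega)) hy, ?_⟩
          rw [← mul_assoc, commute_ascending hc (by omega), mul_assoc]
      · obtain ⟨e, rfl⟩ : ∃ e, d = e + 1 := ⟨d - 1, by omega⟩
        refine ⟨k + 1, e, by omega, by omega, y, hy, ?_⟩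
        rw [ascending, mul_assoc, ← mul_assoc, hs, one_mul]
      · obtain ⟨l, rfl⟩ : ∃ l, k = l + 1 := ⟨k - 1, by omega⟩
        refine ⟨j, d, hj, hd, s l * y, mul_mem (hsm l (by omega) (by omega)) hy, ?_⟩
        rw [← mul_assoc, mul_ascending hc hb hj (by omega) (by omega) (by omega), mul_assoc]
    have normalForm : ∃ j d, 1 ≤ j ∧ j + d = m + 1 ∧
        ∃ y ∈ Subgroup.closure (s '' Set.Ico 1 m), x = ascending s j d * y := by
      clear h1 ih
      induction hx using Subgroup.closure_induction_left with
      | one => exact ⟨m + 1, 0, by omega, rfl, 1, one_mem _, by simp [ascending]⟩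
      | mul_left x hx z _ hz =>
        obtain ⟨k, hk, rfl⟩ := hx
        exact step k hk z hz
      | inv_mul_cancel x hx z _ hz =>
        obtain ⟨k, hk, rfl⟩ := hx
        rw [hinv]
        exact step k hk z hz
    obtain ⟨j, d, hj, hd, y, hy, rfl⟩ := normalForm
    have fix : ψ y (m + 1) = m + 1 := by
      clear h1 hx
      induction hy using Subgroup.closure_induction with
      | mem x hx =>
        obtain ⟨k, ⟨hk1, hk2⟩, rfl⟩ := hx
        rw [hψ k hk1 (by omega), Equiv.swap_apply_of_ne_of_ne] <;> omega
      | one => simp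
      | mul x z _ _ hx hz => rw [map_mul, Equiv.Perm.mul_apply, hz, hx]
      | inv x _ hx => rw [map_inv, Equiv.Perm.inv_eq_iff_eq, hx]
    have move : ∀ d j, 1 ≤ j → j + d ≤ n → ψ (ascending s j d) (j + d) = j := by
      intro d
      induction d with
      | zero => intro j _ _; simp [ascending]
      | succ d ih =>
        intro j h1 h2
        rw [ascending, map_mul, Equiv.Perm.mul_apply, show j + (d + 1) = j + 1 + d by omega,
          ih (j + 1) (by omega) (by omega), hψ j h1 (by omega), Equiv.swap_apply_right]
    have hj' : j = m + 1 := by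
      have := DFunLike.congr_fun h1 (m + 1)
      rwa [map_mul, Equiv.Perm.mul_apply, fix, ← hd, move d j hj (by omega), hd] at this
    obtain rfl : d = 0 := by omega
    rw [ascending, one_mul] at h1 ⊢
    exact ih (by omega) hy h1

/-- Killing the `A_{i,j}` kills the squares `σ_i²`, so the quotient satisfies the Coxeter relations
and its map to permutations is injective. -/
theorem closureA_eq_Pure (n : ℕ) : closureA n = Pure n := by
  have hle : closureA n ≤ Pure n := by
    rw [closureA, Subgroup.closure_le]
    rintro _ ⟨i, j, -, -, -, rfl⟩
    exact A_mem n i j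
  refine le_antisymm hle fun g hg => ?_
  have hker : closureA n ≤ (permNat n).ker := fun h hh => (permNat_eq_one_iff h).2 (hle hh)
  have hgen : ∀ g : Braid n, (QuotientGroup.mk g : Braid n ⧸ closureA n) ∈ Subgroup.closure
      ((fun i => (QuotientGroup.mk (sigma n i) : Braid n ⧸ closureA n)) '' Set.Ico 1 n) := by
    intro g
    induction g using braid_induction with
    | one => exact one_mem _
    | mul x y hx hy => exact mul_mem hx hy
    | inv x hx => exact inv_mem hx
    | gen i h1 h2 => exact Subgroup.subset_closure ⟨i, ⟨h1, h2⟩, rfl⟩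
  rw [← QuotientGroup.eq_one_iff]
  refine eq_one_of_mem_closure_of_perm_eq_one (n := n)
    (s := fun i => (QuotientGroup.mk (sigma n i) : Braid n ⧸ closureA n))
    (ψ := QuotientGroup.lift _ (permNat n) hker) ?_ ?_ ?_ ?_ (le_refl n) (hgen g)
    ((permNat_eq_one_iff g).2 hg)
  · intro i
    rw [← QuotientGroup.mk_mul, QuotientGroup.eq_one_iff, ← pow_two]
    exact sq_sigma_mem_closureA n i
  · intro i j hij
    rw [← QuotientGroup.mk_mul, sigma_comm hij, QuotientGroup.mk_mul]
  · intro i h1 h2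
    simp only [← QuotientGroup.mk_mul, sigma_braid h1 h2]
  · intro i h1 h2
    exact permNat_sigma h1 h2

/-! ### Linking data of the pure braid generators -/

/-- `1` if `{p, q} = {i, j}`, else `0`. -/
def samePair (i j p q : ℕ) : ℤ := if (p = i ∧ q = j) ∨ (p = j ∧ q = i) then 1 else 0

theorem linking_conj {n : ℕ} (g : Braid n) {h : Braid n} (hh : h ∈ Pure n) (p q r : ℕ) :
    linking (g * h * g⁻¹) (permNat n g p) (permNat n g q) (permNat n g r) =
      linking g p q r * linking h p q r * (linking g p q r)⁻¹ := by
  have e : linking g⁻¹ (permNat n g p) (permNat n g q) (permNat n g r) = (linking g p q r)⁻¹ := by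
    rw [eq_inv_iff_mul_eq_one, ← linking_mul, inv_mul_cancel, linking_one]
  have hinv : ∀ x, permNat n g⁻¹ (permNat n g x) = x := fun x => by
    rw [map_inv]; exact Equiv.symm_apply_apply _ x
  simp only [linking_mul, e, hinv, permNat_of_mem hh]

theorem linking_conj_abc (u v : Linking) :
    (u * v * u⁻¹).a = v.a ∧ (u * v * u⁻¹).b = v.b ∧ (u * v * u⁻¹).c = v.c := by
  simp [Linking.mul_def, Linking.inv_def]

theorem linking_A {n i j : ℕ} (hi : 1 ≤ i) (hij : i < j) (hj : j ≤ n) (p q r : ℕ) :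
    (linking (A n i j) p q r).a = 2 * samePair i j p q ∧
    (linking (A n i j) p q r).b = 2 * samePair i j p r ∧
    (linking (A n i j) p q r).c = 2 * samePair i j q r := by
  induction j, hij using Nat.le_induction generalizing p q r with
  | base =>
    have key : ∀ p q, meets i (Equiv.swap i (i + 1) p) (Equiv.swap i (i + 1) q) + meets i p q =
        2 * samePair i (i + 1) p q := by
      intro p q
      simp only [meets, samePair, Equiv.swap_apply_def]
      grind
    rw [A_self, pow_two, linking_mul, permNat_sigma hi (by omega), linking_sigma hi (by omega),
      linking_sigma hi (by omega)]
    exact ⟨key p q, key p r, key q r⟩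
  | succ j hij ih =>
    have key : ∀ p q, samePair i (j + 1) (Equiv.swap j (j + 1) p) (Equiv.swap j (j + 1) q) =
        samePair i j p q := by
      intro p q
      simp only [samePair, Equiv.swap_apply_def]
      grind
    obtain ⟨p, rfl⟩ := (Equiv.swap j (j + 1)).surjective p
    obtain ⟨q, rfl⟩ := (Equiv.swap j (j + 1)).surjective q
    obtain ⟨r, rfl⟩ := (Equiv.swap j (j + 1)).surjective r
    rw [key, key, key, A_succ n hij]
    have h := linking_conj (sigma n j) (A_mem n i j) p q r
    rw [permNat_sigma (by omega) (by omega)] at h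
    rw [h]
    obtain ⟨h1, h2, h3⟩ := linking_conj_abc (linking (sigma n j) p q r) (linking (A n i j) p q r)
    rw [h1, h2, h3]
    exact ih (by omega) p q r

/-! ### The structure of `Γ_2 / Γ_3` -/

theorem mk_mem_Gam2Quot {n : ℕ} {g : Braid n} (hg : g ∈ Gam 2 n) :
    (QuotientGroup.mk g : Quot3 n) ∈ Gam2Quot n := ⟨g, hg, rfl⟩

instance (n : ℕ) : (Gam2Quot n).Normal :=
  Subgroup.Normal.map inferInstance _ (QuotientGroup.mk'_surjective _)

theorem commute_of_mem_Gam2Quot {n : ℕ} {z : Quot3 n} (hz : z ∈ Gam2Quot n) {x : Braid n}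
    (hx : x ∈ Pure n) : Commute z (QuotientGroup.mk x : Quot3 n) := by
  obtain ⟨z, hz, rfl⟩ := hz
  rw [← commutatorElement_eq_one_iff_commute]
  exact (QuotientGroup.eq_one_iff _).2 (Subgroup.commutator_mem_commutator hz hx)

theorem commute_Gam2Quot {n : ℕ} {z w : Quot3 n} (hz : z ∈ Gam2Quot n) (hw : w ∈ Gam2Quot n) :
    Commute z w := by
  obtain ⟨w, hw, rfl⟩ := hw
  exact commute_of_mem_Gam2Quot hz (Gam_two_le n hw)

instance (n : ℕ) : CommGroup (Gam2Quot n) :=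
  { (inferInstance : Group (Gam2Quot n)) with
    mul_comm := fun x y => Subtype.ext (commute_Gam2Quot x.2 y.2) }

theorem alpha_mem {n : ℕ} (t : Triple n) : alpha t ∈ Gam2Quot n :=
  mk_mem_Gam2Quot (Subgroup.commutator_mem_commutator (A_mem _ _ _) (A_mem _ _ _))

/-- `α_t` as an element of `Γ_2 / Γ_3`. -/
def alpha' {n : ℕ} (t : Triple n) : Gam2Quot n := ⟨alpha t, alpha_mem t⟩

theorem theta_eq_prod {n : ℕ} (r : Triple n → ℤ) :
    theta r = ((∏ t, alpha' t ^ r t : Gam2Quot n) : Quot3 n) := by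
  have h := Finset.map_noncommProd Finset.univ (fun t => alpha' t ^ r t)
    (fun _ _ _ _ _ => Commute.all _ _) (Gam2Quot n).subtype
  rw [Finset.noncommProd_eq_prod] at h
  exact h.symm

theorem theta_mem {n : ℕ} (r : Triple n → ℤ) : theta r ∈ Gam2Quot n := by
  rw [theta_eq_prod]; exact SetLike.coe_mem _

theorem theta_add {n : ℕ} (r r' : Triple n → ℤ) : theta (r + r') = theta r * theta r' := by
  simp only [theta_eq_prod, Pi.add_apply, zpow_add, Finset.prod_mul_distrib, Subgroup.coe_mul]

theorem theta_neg {n : ℕ} (r : Triple n → ℤ) : theta (-r) = (theta r)⁻¹ := by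
  simp only [theta_eq_prod, Pi.neg_apply, zpow_neg, Finset.prod_inv_distrib, Subgroup.coe_inv]

theorem theta_zero {n : ℕ} : theta (0 : Triple n → ℤ) = 1 := by
  simp [theta_eq_prod]

theorem theta_single {n : ℕ} (t : Triple n) : theta (Pi.single t 1) = alpha t := by
  rw [theta_eq_prod, Finset.prod_eq_single t]
  · simp [alpha']
  · intro u _ hu; simp [Pi.single_eq_of_ne hu]
  · simp

/-- The coordinate of `Γ_2 / Γ_3` given by the linking data of three strands. -/
def coord (n p q r : ℕ) : Gam2Quot n →* Multiplicative ℤ where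
  toFun g := Multiplicative.ofAdd (linkingQuot n g ((p, q, r), 1)).2.x
  map_one' := by simp [Linking.one_def]
  map_mul' := by
    rintro ⟨_, g, hg, rfl⟩ ⟨_, h, hh, rfl⟩
    change Multiplicative.ofAdd (linking (g * h) p q r).x =
      Multiplicative.ofAdd (linking g p q r).x * Multiplicative.ofAdd (linking h p q r).x
    have hP := Gam_two_le n hh
    rw [linking_mul, permNat_of_mem hP, permNat_of_mem hP, permNat_of_mem hP,
      linking_of_mem_Gam_two hg, linking_of_mem_Gam_two hh]
    simp [Linking.mul_def]

/-- Here 24 is the factor 6 of the commutator in `Linking` times the two entries 2 of `linking_A`.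
The commutator survives only if both index pairs lie among the three chosen strands, that is, if the
triples agree. -/
theorem coord_alpha {n : ℕ} (t u : Triple n) :
    coord n (t.1.1 + 1) (t.1.2.1 + 1) (t.1.2.2 + 1) (alpha' u) =
      Multiplicative.ofAdd (if u = t then 24 else 0) := by
  obtain ⟨⟨i, j, k⟩, hij, hjk⟩ := u
  obtain ⟨⟨p, q, r⟩, hpq, hqr⟩ := t
  change Multiplicative.ofAdd (linking ⁅A n (i + 1) (j + 1), A n (j + 1) (k + 1)⁆ (p + 1) (q + 1)
    (r + 1)).x = _
  rw [linking_commutator (A_mem _ _ _) (A_mem _ _ _), Linking.commutator_def]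
  simp only at hij hjk hpq hqr
  rw [Fin.lt_def] at hij hjk hpq hqr
  obtain ⟨h1, h2, h3⟩ := linking_A (n := n) (i := i + 1) (j := j + 1) (by omega) (by omega)
    (by omega) (p + 1) (q + 1) (r + 1)
  obtain ⟨h4, h5, h6⟩ := linking_A (n := n) (i := j + 1) (j := k + 1) (by omega) (by omega)
    (by omega) (p + 1) (q + 1) (r + 1)
  simp only [h1, h2, h3, h4, h5, h6, samePair, Subtype.mk.injEq, Prod.mk.injEq, Fin.ext_iff]
  congr 1
  by_cases e : (p : ℕ) = i ∧ (q : ℕ) = j ∧ (r : ℕ) = k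
  · obtain ⟨e1, e2, e3⟩ := e
    rw [e1, e2, e3]
    grind
  · grind

theorem coord_theta {n : ℕ} (t : Triple n) (r : Triple n → ℤ) :
    linkingQuot n (theta r) (((t.1.1 : ℕ) + 1, (t.1.2.1 : ℕ) + 1, (t.1.2.2 : ℕ) + 1), 1) =
      (((t.1.1 : ℕ) + 1, (t.1.2.1 : ℕ) + 1, (t.1.2.2 : ℕ) + 1), ⟨0, 0, 0, 24 * r t⟩) := by
  obtain ⟨g, hg, e⟩ := theta_mem r
  have h1 : linkingQuot n (theta r) (((t.1.1 : ℕ) + 1, (t.1.2.1 : ℕ) + 1, (t.1.2.2 : ℕ) + 1), 1) =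
      (((t.1.1 : ℕ) + 1, (t.1.2.1 : ℕ) + 1, (t.1.2.2 : ℕ) + 1), ⟨0, 0, 0,
        (linkingQuot n (theta r) (((t.1.1 : ℕ) + 1, (t.1.2.1 : ℕ) + 1, (t.1.2.2 : ℕ) + 1), 1)).2.x⟩) := by
    rw [← e]
    change linkingAction n g _ = (_, Linking.mk 0 0 0 (linking g _ _ _).x)
    have hP := Gam_two_le n hg
    rw [linkingAction_apply, permNat_of_mem hP, permNat_of_mem hP, permNat_of_mem hP,
      ← linking_of_mem_Gam_two hg, mul_one]
  have h2 : (linkingQuot n (theta r) (((t.1.1 : ℕ) + 1, (t.1.2.1 : ℕ) + 1, (t.1.2.2 : ℕ) + 1), 1)).2.x =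
      24 * r t := by
    rw [theta_eq_prod]
    change (coord n (t.1.1 + 1) (t.1.2.1 + 1) (t.1.2.2 + 1) (∏ t, alpha' t ^ r t)).toAdd = _
    rw [map_prod]
    simp only [map_zpow, coord_alpha, toAdd_prod, toAdd_zpow, toAdd_ofAdd]
    simp [mul_comm]
  rw [h1, h2]

theorem theta_injective_of_linkingQuot {s : ℕ} {r r' : Triple s → ℤ}
    (h : linkingQuot s (theta r) = linkingQuot s (theta r')) : r = r' := by
  funext t
  have h1 := coord_theta t r
  rw [h, coord_theta t r'] at h1
  simp only [Prod.mk.injEq, Linking.mk.injEq] at h1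
  omega

theorem theta_injective {n : ℕ} : Function.Injective (theta : (Triple n → ℤ) → Quot3 n) :=
  fun _ _ h => theta_injective_of_linkingQuot (congrArg _ h)

theorem alpha_injective {n : ℕ} : Function.Injective (alpha : Triple n → Quot3 n) := by
  intro t u h
  rw [← theta_single, ← theta_single] at h
  have := congrFun (theta_injective h) t
  by_contra hne
  simp [Pi.single_eq_of_ne hne] at this

theorem mk_commutator_mem {n : ℕ} {x y : Braid n} (hx : x ∈ Pure n) (hy : y ∈ Pure n) :
    (QuotientGroup.mk ⁅x, y⁆ : Quot3 n) ∈ Gam2Quot n :=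
  mk_mem_Gam2Quot (Subgroup.commutator_mem_commutator hx hy)

theorem mk_commutator_mul_left {n : ℕ} {x y z : Braid n} (hx : x ∈ Pure n) (hy : y ∈ Pure n)
    (hz : z ∈ Pure n) : (QuotientGroup.mk ⁅x * y, z⁆ : Quot3 n) =
      QuotientGroup.mk ⁅x, z⁆ * QuotientGroup.mk ⁅y, z⁆ := by
  have h1 := commute_of_mem_Gam2Quot (mk_commutator_mem hy hz) hx
  have h2 := commute_Gam2Quot (mk_commutator_mem hy hz) (mk_commutator_mem hx hz)
  rw [show ⁅x * y, z⁆ = x * ⁅y, z⁆ * x⁻¹ * ⁅x, z⁆ by simp only [commutatorElement_def]; group,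
    QuotientGroup.mk_mul, QuotientGroup.mk_mul, QuotientGroup.mk_mul, QuotientGroup.mk_inv,
    ← h1.eq, mul_inv_cancel_right, h2.eq]

theorem mk_commutator_symm {n : ℕ} (x y : Braid n) :
    (QuotientGroup.mk ⁅y, x⁆ : Quot3 n) = (QuotientGroup.mk ⁅x, y⁆)⁻¹ := by
  rw [← QuotientGroup.mk_inv, commutatorElement_inv]

theorem mk_commutator_mul_right {n : ℕ} {x y z : Braid n} (hx : x ∈ Pure n) (hy : y ∈ Pure n)
    (hz : z ∈ Pure n) : (QuotientGroup.mk ⁅x, y * z⁆ : Quot3 n) =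
      QuotientGroup.mk ⁅x, y⁆ * QuotientGroup.mk ⁅x, z⁆ := by
  rw [mk_commutator_symm, mk_commutator_mul_left hy hz hx, mul_inv_rev, ← mk_commutator_symm,
    ← mk_commutator_symm]
  exact commute_Gam2Quot (mk_commutator_mem hx hz) (mk_commutator_mem hx hy)

theorem mk_commutator_inv_left {n : ℕ} {x y : Braid n} (hx : x ∈ Pure n) (hy : y ∈ Pure n) :
    (QuotientGroup.mk ⁅x⁻¹, y⁆ : Quot3 n) = (QuotientGroup.mk ⁅x, y⁆)⁻¹ := by
  rw [eq_inv_iff_mul_eq_one, ← mk_commutator_mul_left (inv_mem hx) hx hy]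
  simp

theorem mk_commutator_Gam_two_mul {n : ℕ} {w x y : Braid n} (hw : w ∈ Gam 2 n)
    (hx : x ∈ Pure n) (hy : y ∈ Pure n) :
    (QuotientGroup.mk ⁅w * x, y⁆ : Quot3 n) = QuotientGroup.mk ⁅x, y⁆ := by
  have h : (QuotientGroup.mk ⁅w, y⁆ : Quot3 n) = 1 :=
    (QuotientGroup.eq_one_iff _).2 (Subgroup.commutator_mem_commutator hw hy)
  rw [mk_commutator_mul_left (Gam_two_le n hw) hx hy, h, one_mul]

theorem pairA_mem_Pure (n i j : ℕ) : pairA n i j ∈ Pure n := A_mem _ _ _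

/-- Modulo `Γ_2(P_n)`, braids permute the pure braids `A_{i,j}` by conjugation. -/
theorem conj_pairA {n : ℕ} (g : Braid n) {i j : ℕ} (hi : 1 ≤ i ∧ i ≤ n) (hj : 1 ≤ j ∧ j ≤ n)
    (hij : i ≠ j) : ∃ w ∈ Gam 2 n,
      g * pairA n i j * g⁻¹ = w * pairA n (permNat n g i) (permNat n g j) := by
  induction g using braid_induction generalizing i j with
  | one => exact ⟨1, one_mem _, by simp⟩
  | mul x y hx hy =>
    obtain ⟨w, hw, e⟩ := hy hi hj hij
    obtain ⟨w', hw', e'⟩ := hx ((permNat_mem_iff y i).2 hi) ((permNat_mem_iff y j).2 hj)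
      (fun h => hij ((permNat n y).injective h))
    refine ⟨x * w * x⁻¹ * w', mul_mem (Subgroup.Normal.conj_mem inferInstance _ hw x) hw', ?_⟩
    rw [map_mul, Equiv.Perm.mul_apply, Equiv.Perm.mul_apply, mul_assoc _ w', ← e',
      show x * y * pairA n i j * (x * y)⁻¹ = x * (y * pairA n i j * y⁻¹) * x⁻¹ by group, e]
    group
  | inv x hx =>
    obtain ⟨i, rfl⟩ := (permNat n x).surjective i
    obtain ⟨j, rfl⟩ := (permNat n x).surjective j
    obtain ⟨w, hw, e⟩ := hx ((permNat_mem_iff x i).1 hi) ((permNat_mem_iff x j).1 hj)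
      (fun h => hij (congrArg _ h))
    refine ⟨x⁻¹ * w⁻¹ * (x⁻¹)⁻¹, Subgroup.Normal.conj_mem inferInstance _ (inv_mem hw) _, ?_⟩
    have hinv : ∀ k, permNat n x⁻¹ (permNat n x k) = k := fun k => by
      rw [map_inv]; exact Equiv.symm_apply_apply _ k
    rw [hinv, hinv, ← inv_mul_eq_iff_eq_mul.2 e]
    group
  | gen k h1 h2 =>
    have key : ∀ i j, 1 ≤ i → i < j → j ≤ n → ∃ w ∈ Gam 2 n,
        sigma n k * pairA n i j * (sigma n k)⁻¹ =
          w * pairA n (permNat n (sigma n k) i) (permNat n (sigma n k) j) := by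
      intro i j hi hij hj
      obtain ⟨h, hh, e⟩ := sigma_conj_A h1 hi hij hj
      rw [pairA_of_lt n hij, permNat_sigma h1 h2]
      rw [closureA_eq_Pure] at hh
      refine ⟨_, Subgroup.commutator_mem_commutator hh (pairA_mem_Pure n
        (Equiv.swap k (k + 1) i) (Equiv.swap k (k + 1) j)), e.trans ?_⟩
      rw [commutatorElement_def]
      group
    rcases lt_or_gt_of_ne hij with h | h
    · exact key i j hi.1 h hj.2
    · rw [pairA_comm, pairA_comm n (permNat n (sigma n k) i)]
      exact key j i hj.1 h hi.2

/-- `α_{a,b,c}` for three distinct positions in any order. -/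
def triA (n a b c : ℕ) : Quot3 n := QuotientGroup.mk ⁅pairA n a b, pairA n b c⁆

/-- The error terms of `conj_pairA` lie in `Γ_2(P_n)` and disappear inside a commutator modulo
`Γ_3(P_n)`. -/
theorem conj_commutator_pairA {n : ℕ} (g : Braid n) {i j k l : ℕ} (hi : 1 ≤ i ∧ i ≤ n)
    (hj : 1 ≤ j ∧ j ≤ n) (hk : 1 ≤ k ∧ k ≤ n) (hl : 1 ≤ l ∧ l ≤ n) (hij : i ≠ j) (hkl : k ≠ l) :
    (QuotientGroup.mk g * QuotientGroup.mk ⁅pairA n i j, pairA n k l⁆ * (QuotientGroup.mk g)⁻¹ :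
      Quot3 n) = QuotientGroup.mk ⁅pairA n (permNat n g i) (permNat n g j),
        pairA n (permNat n g k) (permNat n g l)⁆ := by
  obtain ⟨w, hw, e⟩ := conj_pairA g hi hj hij
  obtain ⟨w', hw', e'⟩ := conj_pairA g hk hl hkl
  rw [← QuotientGroup.mk_inv, ← QuotientGroup.mk_mul, ← QuotientGroup.mk_mul,
    conjugate_commutatorElement, e, e',
    mk_commutator_Gam_two_mul hw (pairA_mem_Pure _ _ _)
      (mul_mem (Gam_two_le n hw') (pairA_mem_Pure _ _ _)),
    mk_commutator_symm, mk_commutator_Gam_two_mul hw' (pairA_mem_Pure _ _ _)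
      (pairA_mem_Pure _ _ _), ← mk_commutator_symm]

theorem perm_surjective (n : ℕ) : Function.Surjective (perm n) := by
  rcases n with _ | n
  · intro x; exact ⟨1, Subsingleton.elim _ _⟩
  · intro x
    have hx : x ∈ Submonoid.closure (Set.range fun i : Fin n => Equiv.swap i.castSucc i.succ) := by
      rw [Equiv.Perm.mclosure_swap_castSucc_succ]; trivial
    induction hx using Submonoid.closure_induction with
    | mem x hx =>
      obtain ⟨i, rfl⟩ := hx
      refine ⟨PresentedGroup.of i, ?_⟩
      rw [perm, PresentedGroup.toGroup.of]
      rfl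
    | one => exact ⟨1, map_one _⟩
    | mul x y _ _ hx hy =>
      obtain ⟨g, rfl⟩ := hx
      obtain ⟨h, rfl⟩ := hy
      exact ⟨g * h, map_mul _ _ _⟩

theorem exists_permNat {n m : ℕ} (f : Fin m → ℕ) (hf : Function.Injective f)
    (hr : ∀ x, 1 ≤ f x ∧ f x ≤ n) :
    m ≤ n ∧ ∃ g : Braid n, ∀ x : Fin m, permNat n g (x + 1) = f x := by
  let f' : Fin m ↪ Fin n := ⟨fun x => ⟨f x - 1, by have := hr x; omega⟩, fun x y h => by
    apply hf
    have h1 := hr x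
    have h2 := hr y
    simp only [Fin.mk.injEq] at h
    omega⟩
  have hmn : m ≤ n := by simpa using Fintype.card_le_of_embedding f'
  refine ⟨hmn, ?_⟩
  obtain ⟨σ, hσ⟩ := (Equiv.Perm.isMultiplyPretransitive (Fin n) m).exists_smul_eq
    (Fin.castLEEmb hmn) f'
  obtain ⟨g, rfl⟩ := perm_surjective n σ
  refine ⟨g, fun x => ?_⟩
  have h1 := permNat_perm g (Fin.castLE hmn x)
  have h2 : perm n g (Fin.castLE hmn x) = f' x := DFunLike.congr_fun hσ x
  rw [h2] at h1
  have := hr x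
  simp only [Fin.val_castLE] at h1
  have h3 : (f' x : ℕ) = f x - 1 := rfl
  rw [h1, h3]
  omega

/-- Some braid carries the positions `1, 2, 3, 4` to `i, j, k, l`, and `A_{1,2}` commutes with
`A_{3,4}`. -/
theorem commutator_pairA_of_disjoint {n i j k l : ℕ} (hi : 1 ≤ i ∧ i ≤ n)
    (hj : 1 ≤ j ∧ j ≤ n) (hk : 1 ≤ k ∧ k ≤ n) (hl : 1 ≤ l ∧ l ≤ n)
    (h : List.Nodup [i, j, k, l]) :
    (QuotientGroup.mk ⁅pairA n i j, pairA n k l⁆ : Quot3 n) = 1 := by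
  obtain ⟨hn, g, hg⟩ := exists_permNat (n := n) ![i, j, k, l]
    (List.nodup_ofFn.1 (by simpa using h)) (fun x => by fin_cases x <;> simpa)
  have h0 : permNat n g 1 = i := hg 0
  have h1 : permNat n g 2 = j := hg 1
  have h2 : permNat n g 3 = k := hg 2
  have h3 : permNat n g 4 = l := hg 3
  rw [← h0, ← h1, ← h2, ← h3, ← conj_commutator_pairA g (by omega) (by omega) (by omega) (by omega)
    (by omega) (by omega)]
  have e : ⁅pairA n 1 2, pairA n 3 4⁆ = 1 := by
    rw [commutatorElement_eq_one_iff_commute, pairA_of_lt n (by omega), pairA_of_lt n (by omega),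
      A_self]
    exact (sigma_commute_A (by omega) (Or.inr (by omega))).pow_left 2
  rw [e]
  simp

/-- Conjugation reduces this to the indices `1, 2, 3`. There `A_{1,3} A_{2,3} = σ_2 σ_1² σ_2`
commutes with `σ_1`, and bilinearity of the commutator with `A_{1,2}` gives the rotation. -/
theorem triA_rotate {n a b c : ℕ} (ha : 1 ≤ a ∧ a ≤ n) (hb : 1 ≤ b ∧ b ≤ n)
    (hc : 1 ≤ c ∧ c ≤ n) (h : List.Nodup [a, b, c]) : triA n a b c = triA n c a b := by
  obtain ⟨hn, g, hg⟩ := exists_permNat (n := n) ![a, b, c]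
    (List.nodup_ofFn.1 (by simpa using h)) (fun x => by fin_cases x <;> simpa)
  have h0 : permNat n g 1 = a := hg 0
  have h1 : permNat n g 2 = b := hg 1
  have h2 : permNat n g 3 = c := hg 2
  rw [triA, triA, ← h0, ← h1, ← h2, ← conj_commutator_pairA g (by omega) (by omega) (by omega)
    (by omega) (by omega) (by omega), ← conj_commutator_pairA g (by omega) (by omega) (by omega)
    (by omega) (by omega) (by omega)]
  congr 2
  rw [pairA_comm n 3 1, mk_commutator_symm (pairA n 1 2) (pairA n 1 3), eq_comm,
    inv_eq_iff_mul_eq_one]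
  rw [← mk_commutator_mul_right (pairA_mem_Pure _ _ _) (pairA_mem_Pure _ _ _)
    (pairA_mem_Pure _ _ _)]
  have e : ⁅pairA n 1 2, pairA n 1 3 * pairA n 2 3⁆ = 1 := by
    rw [commutatorElement_eq_one_iff_commute, pairA_of_lt n (by omega), pairA_of_lt n (by omega),
      pairA_of_lt n (by omega), A_self, A_self, A_succ n (by omega), A_self]
    have hb := sigma_braid (n := n) (i := 1) le_rfl (by omega)
    simp only [show 1 + 1 = 2 from rfl] at *
    generalize sigma n 1 = s at *
    generalize sigma n 2 = t at *
    refine Commute.pow_left ?_ 2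
    have e1 : t * s ^ 2 * t⁻¹ * t ^ 2 = t * s * s * t := by rw [pow_two, pow_two]; group
    rw [e1]
    calc s * (t * s * s * t) = (s * t * s) * s * t := by group
      _ = t * s * (t * s * t) := by rw [← hb]; group
      _ = t * s * s * t * s := by rw [hb]; group
  rw [e]
  rfl

theorem triA_symm (n a b c : ℕ) : triA n c b a = (triA n a b c)⁻¹ := by
  rw [triA, triA, mk_commutator_symm, pairA_comm n b a, pairA_comm n c b]

theorem alpha_eq_triA {n : ℕ} (t : Triple n) :
    alpha t = triA n (t.1.1 + 1) (t.1.2.1 + 1) (t.1.2.2 + 1) := by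
  have h1 := Fin.lt_def.1 t.2.1
  have h2 := Fin.lt_def.1 t.2.2
  rw [triA, pairA_of_lt n (by omega), pairA_of_lt n (by omega)]
  rfl

/-- The subgroup of the elements `θ(r)`. -/
def thetaRange (n : ℕ) : Subgroup (Quot3 n) where
  carrier := Set.range theta
  one_mem' := ⟨0, theta_zero⟩
  mul_mem' := by
    rintro _ _ ⟨r, rfl⟩ ⟨r', rfl⟩
    exact ⟨r + r', theta_add r r'⟩
  inv_mem' := by
    rintro _ ⟨r, rfl⟩
    exact ⟨-r, theta_neg r⟩

theorem alpha_mem_thetaRange {n : ℕ} (t : Triple n) : alpha t ∈ thetaRange n :=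
  ⟨_, theta_single t⟩

theorem exists_alpha_eq {n i j k : ℕ} (hi : 1 ≤ i) (hij : i < j) (hjk : j < k) (hk : k ≤ n) :
    ∃ t : Triple n, (t.1.1 + 1 : ℕ) = i ∧ (t.1.2.1 + 1 : ℕ) = j ∧ (t.1.2.2 + 1 : ℕ) = k ∧
      triA n i j k = alpha t := by
  let t : Triple n := ⟨(⟨i - 1, by omega⟩, ⟨j - 1, by omega⟩, ⟨k - 1, by omega⟩),
    by constructor <;> (rw [Fin.lt_def]; simp only; omega)⟩
  have h1 : (t.1.1 + 1 : ℕ) = i := by simp only [t]; omega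
  have h2 : (t.1.2.1 + 1 : ℕ) = j := by simp only [t]; omega
  have h3 : (t.1.2.2 + 1 : ℕ) = k := by simp only [t]; omega
  exact ⟨t, h1, h2, h3, by rw [alpha_eq_triA, h1, h2, h3]⟩

theorem triA_mem_of_lt {n i j k : ℕ} (hi : 1 ≤ i) (hij : i < j) (hjk : j < k) (hk : k ≤ n) :
    triA n i j k ∈ thetaRange n := by
  obtain ⟨t, -, -, -, e⟩ := exists_alpha_eq hi hij hjk hk
  rw [e]
  exact alpha_mem_thetaRange t

theorem triA_mem {n a b c : ℕ} (ha : 1 ≤ a ∧ a ≤ n) (hb : 1 ≤ b ∧ b ≤ n)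
    (hc : 1 ≤ c ∧ c ≤ n) (h : List.Nodup [a, b, c]) : triA n a b c ∈ thetaRange n := by
  have cyc : ∀ a b c, (1 ≤ a ∧ a ≤ n) → (1 ≤ b ∧ b ≤ n) → (1 ≤ c ∧ c ≤ n) →
      (a < b ∧ b < c) ∨ (b < c ∧ c < a) ∨ (c < a ∧ a < b) → triA n a b c ∈ thetaRange n := by
    rintro a b c ha hb hc (h | h | h)
    · exact triA_mem_of_lt ha.1 h.1 h.2 hc.2
    · rw [triA_rotate ha hb hc (by simp; omega), triA_rotate hc ha hb (by simp; omega)]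
      exact triA_mem_of_lt hb.1 h.1 h.2 ha.2
    · rw [triA_rotate ha hb hc (by simp; omega)]
      exact triA_mem_of_lt hc.1 h.1 h.2 hb.2
  simp only [List.nodup_cons, List.mem_cons, List.not_mem_nil, or_false, not_or] at h
  by_cases h' : (a < b ∧ b < c) ∨ (b < c ∧ c < a) ∨ (c < a ∧ a < b)
  · exact cyc a b c ha hb hc h'
  · rw [triA_symm]
    exact inv_mem (cyc c b a hc hb ha (by omega))

theorem mk_commutator_pairA_mem {n i j k l : ℕ} (hi : 1 ≤ i ∧ i ≤ n)
    (hj : 1 ≤ j ∧ j ≤ n) (hk : 1 ≤ k ∧ k ≤ n) (hl : 1 ≤ l ∧ l ≤ n) (hij : i ≠ j) (hkl : k ≠ l) :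
    (QuotientGroup.mk ⁅pairA n i j, pairA n k l⁆ : Quot3 n) ∈ thetaRange n := by
  have shared : ∀ i j l, (1 ≤ i ∧ i ≤ n) → (1 ≤ j ∧ j ≤ n) → (1 ≤ l ∧ l ≤ n) → i ≠ j → j ≠ l →
      (QuotientGroup.mk ⁅pairA n i j, pairA n j l⁆ : Quot3 n) ∈ thetaRange n := by
    intro i j l hi hj hl hij hjl
    by_cases h : i = l
    · subst h
      rw [pairA_comm n j i, commutatorElement_self]
      exact one_mem _
    · exact triA_mem hi hj hl (by simp; omega)
  by_cases h1 : j = k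
  · subst h1; exact shared i j l hi hj hl hij hkl
  by_cases h2 : i = k
  · subst h2; rw [pairA_comm n i j]; exact shared j i l hj hi hl hij.symm hkl
  by_cases h3 : j = l
  · subst h3; rw [pairA_comm n k j]; exact shared i j k hi hj hk hij hkl.symm
  by_cases h4 : i = l
  · subst h4; rw [pairA_comm n i j, pairA_comm n k i]; exact shared j i k hj hi hk hij.symm hkl.symm
  rw [commutator_pairA_of_disjoint hi hj hk hl (by simp; omega)]
  exact one_mem _

theorem mk_commutator_mem_thetaRange {n : ℕ} {x y : Braid n} (hx : x ∈ Pure n) (hy : y ∈ Pure n) :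
    (QuotientGroup.mk ⁅x, y⁆ : Quot3 n) ∈ thetaRange n := by
  have hle : ∀ z, z ∈ closureA n → z ∈ Pure n := fun z hz => closureA_eq_Pure n ▸ hz
  rw [← closureA_eq_Pure, closureA] at hx hy
  induction hx using Subgroup.closure_induction with
  | one => simp [one_mem]
  | mul x x' hx hx' ih ih' =>
    rw [mk_commutator_mul_left (hle _ hx) (hle _ hx') (hle _ hy)]
    exact mul_mem ih ih'
  | inv x hx ih =>
    rw [mk_commutator_inv_left (hle _ hx) (hle _ hy)]
    exact inv_mem ih
  | mem x hx =>
    obtain ⟨i, j, hi, hij, hj, rfl⟩ := hx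
    rw [← inv_mem_iff, ← mk_commutator_symm]
    induction hy using Subgroup.closure_induction with
    | one => simp [one_mem]
    | mul y y' hy hy' ih ih' =>
      rw [mk_commutator_mul_left (hle _ hy) (hle _ hy') (A_mem n i j)]
      exact mul_mem ih ih'
    | inv y hy ih =>
      rw [mk_commutator_inv_left (hle _ hy) (A_mem n i j)]
      exact inv_mem ih
    | mem y hy =>
      obtain ⟨k, l, hk, hkl, hl, rfl⟩ := hy
      rw [← pairA_of_lt n hij, ← pairA_of_lt n hkl]
      exact mk_commutator_pairA_mem (by omega) (by omega) (by omega) (by omega) (by omega)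
        (by omega)

theorem Gam2Quot_le_thetaRange (n : ℕ) : Gam2Quot n ≤ thetaRange n := by
  rw [Gam2Quot, Subgroup.map_le_iff_le_comap, Gam_two_eq, Subgroup.commutator_le]
  exact fun x hx y hy => mk_commutator_mem_thetaRange hx hy

/-! ### Pure braids with vanishing linking numbers -/

/-- The linking numbers recover the exponents of a pure braid in the abelianization, so their
vanishing forces membership in `Γ_2(P_n)`. -/
theorem exists_exponents {n : ℕ} {g : Braid n} (hg : g ∈ closureA n) :
    ∃ (h : g ∈ Pure n) (e : {x : ℕ × ℕ // x.1 < x.2} →₀ ℤ),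
      Abelianization.of (⟨g, h⟩ : Pure n) = e.prod (fun x k =>
        Abelianization.of (⟨A n x.1.1 x.1.2, A_mem _ _ _⟩ : Pure n) ^ k) ∧
      ∀ x : {x : ℕ × ℕ // x.1 < x.2}, ∀ r, (linking g x.1.1 x.1.2 r).a = 2 * e x := by
  rw [closureA] at hg
  induction hg using Subgroup.closure_induction with
  | one => exact ⟨one_mem _, 0, by rw [Finsupp.prod_zero_index]; exact map_one _,
      by simp [linking_one, Linking.one_def]⟩
  | mul x y _ _ ihx ihy =>
    obtain ⟨hx, e, h1, h2⟩ := ihx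
    obtain ⟨hy, e', h1', h2'⟩ := ihy
    refine ⟨mul_mem hx hy, e + e', ?_, ?_⟩
    · rw [Finsupp.prod_add_index' (fun _ => zpow_zero _) (fun _ _ _ => zpow_add _ _ _), ← h1, ← h1',
        ← map_mul]
      rfl
    · intro x r
      rw [linking_mul, permNat_of_mem hy, permNat_of_mem hy, permNat_of_mem hy, Linking.mul_def]
      simp [h2, h2', mul_add]
  | inv x _ ihx =>
    obtain ⟨hx, e, h1, h2⟩ := ihx
    refine ⟨inv_mem hx, -e, ?_, ?_⟩
    · rw [Finsupp.prod_neg_index (fun _ => zpow_zero _)]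
      simp only [zpow_neg]
      rw [Finsupp.prod_inv, ← h1, ← map_inv]
      rfl
    · intro x r
      rw [linking_inv hx, Linking.inv_def]
      simp [h2]
  | mem x hx =>
    obtain ⟨i, j, hi, hij, hj, rfl⟩ := hx
    refine ⟨A_mem _ _ _, Finsupp.single ⟨(i, j), hij⟩ 1, ?_, ?_⟩
    · rw [Finsupp.prod_single_index (zpow_zero _), zpow_one]
    · rintro ⟨⟨p, q⟩, hpq⟩ r
      rw [(linking_A hi hij hj p q r).1, samePair, Finsupp.single_apply]
      simp only at hpq
      simp only [Subtype.mk.injEq, Prod.mk.injEq]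
      grind

theorem mem_Gam_two_of_linking {n : ℕ} {g : Braid n} (hg : g ∈ Pure n)
    (h : ∀ p q r, p < q → (linking g p q r).a = 0) : g ∈ Gam 2 n := by
  obtain ⟨hg', e, h1, h2⟩ := exists_exponents (closureA_eq_Pure n ▸ hg : g ∈ closureA n)
  have he : e = 0 := by
    ext x
    have := h2 x 0
    rw [h _ _ _ x.2] at this
    simp only [Finsupp.coe_zero, Pi.zero_apply]
    omega
  rw [he, Finsupp.prod_zero_index] at h1
  have h3 : (⟨g, hg'⟩ : Pure n) ∈ commutator (Pure n) := (QuotientGroup.eq_one_iff _).1 h1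
  rw [Gam_two_eq, ← Subgroup.map_subtype_commutator]
  exact ⟨_, h3, rfl⟩

/-! ### The braid `δ_n` -/

/-- The product `σ_m ^ ε m * ⋯ * σ_1 ^ ε 1`. -/
def descending (n : ℕ) (ε : ℕ → ℤ) : ℕ → Braid n
  | 0 => 1
  | m + 1 => sigma n (m + 1) ^ ε (m + 1) * descending n ε m

/-- The signs of the crossings in `δ_n`. -/
def deltaSign (n k : ℕ) : ℤ := if k < (n + 1) / 2 then -1 else 1

theorem delta_eq {n : ℕ} (hn : 1 ≤ n) :
    delta n = QuotientGroup.mk (descending n (deltaSign n) (n - 1)) := by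
  have h1 : ∀ m, 1 ≤ m → m ≤ (n + 1) / 2 →
      ((List.Ico 1 m).reverse.map (fun i => (sigma n i)⁻¹)).prod =
        descending n (deltaSign n) (m - 1) := by
    intro m hm
    induction m, hm using Nat.le_induction with
    | base => simp [descending]
    | succ m hm ih =>
      intro h
      obtain ⟨l, rfl⟩ : ∃ l, m = l + 1 := ⟨m - 1, by omega⟩
      rw [List.Ico.succ_top hm]
      simp only [List.reverse_append, List.reverse_singleton, List.singleton_append, List.map_cons,
        List.prod_cons]
      rw [ih (by omega)]
      simp only [Nat.add_sub_cancel, descending]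
      rw [deltaSign, if_pos (by omega), zpow_neg_one]
  have h2 : ∀ m, (n + 1) / 2 ≤ m →
      ((List.Ico ((n + 1) / 2) m).reverse.map (sigma n)).prod *
        descending n (deltaSign n) ((n + 1) / 2 - 1) = descending n (deltaSign n) (m - 1) := by
    intro m hm
    induction m, hm using Nat.le_induction with
    | base => simp
    | succ m hm ih =>
      obtain ⟨l, rfl⟩ : ∃ l, m = l + 1 := ⟨m - 1, by omega⟩
      rw [List.Ico.succ_top hm]
      simp only [List.reverse_append, List.reverse_singleton, List.singleton_append, List.map_cons,
        List.prod_cons]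
      rw [mul_assoc, ih]
      simp only [Nat.add_sub_cancel, descending]
      rw [deltaSign, if_neg (by omega), zpow_one]
  rw [delta, h1 _ (by omega) le_rfl, h2 n (by omega)]

theorem sigma_zpow {n i : ℕ} {e : ℤ} (he : e = 1 ∨ e = -1) (h1 : 1 ≤ i) (h2 : i < n)
    (p q r : ℕ) : permNat n (sigma n i ^ e) p = Equiv.swap i (i + 1) p ∧
      (linking (sigma n i ^ e) p q r).a = e * meets i p q := by
  rcases he with rfl | rfl
  · rw [zpow_one, permNat_sigma h1 h2, linking_sigma h1 h2]
    simp [crossing]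
  · rw [zpow_neg_one, map_inv, permNat_sigma h1 h2]
    refine ⟨by rw [Equiv.swap_inv], ?_⟩
    have h := linking_mul (sigma n i) (sigma n i)⁻¹ p q r
    rw [mul_inv_cancel, linking_one, map_inv, permNat_sigma h1 h2, linking_sigma h1 h2,
      Equiv.swap_inv] at h
    have ha := congrArg Linking.a h
    have hm : meets i (Equiv.swap i (i + 1) p) (Equiv.swap i (i + 1) q) = meets i p q := by
      simp only [meets, Equiv.swap_apply_def]
      grind
    simp only [Linking.mul_def, crossing, Linking.one_def, hm] at ha
    linarith

theorem permNat_descending {n : ℕ} {ε : ℕ → ℤ} (hε : ∀ k, ε k = 1 ∨ ε k = -1) {m : ℕ}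
    (hm : m < n) (p : ℕ) : permNat n (descending n ε m) p =
      if p = 1 then m + 1 else if 2 ≤ p ∧ p ≤ m + 1 then p - 1 else p := by
  induction m with
  | zero => simp only [descending, map_one, Equiv.Perm.coe_one, id_eq]; grind
  | succ m ih =>
    rw [descending, map_mul, Equiv.Perm.mul_apply, ih (by omega),
      (sigma_zpow (hε _) (by omega) hm _ 0 0).1, Equiv.swap_apply_def]
    grind

theorem linking_descending {n : ℕ} {ε : ℕ → ℤ} (hε : ∀ k, ε k = 1 ∨ ε k = -1) {m : ℕ}
    (hm : m < n) (p q r : ℕ) : (linking (descending n ε m) p q r).a =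
      (if p = 1 ∧ 2 ≤ q ∧ q ≤ m + 1 then ε (q - 1) else 0) +
        (if q = 1 ∧ 2 ≤ p ∧ p ≤ m + 1 then ε (p - 1) else 0) := by
  induction m with
  | zero =>
    rw [descending, linking_one, if_neg (by omega), if_neg (by omega)]
    rfl
  | succ m ih =>
    rw [descending, linking_mul, Linking.mul_def]
    simp only
    rw [ih (by omega), (sigma_zpow (hε _) (by omega) hm _ _ _).2,
      permNat_descending hε (by omega), permNat_descending hε (by omega)]
    simp only [meets]
    grind

theorem deltaSign_eq (n k : ℕ) : deltaSign n k = 1 ∨ deltaSign n k = -1 := by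
  unfold deltaSign; split_ifs <;> simp

theorem deltaSign_add {n k l : ℕ} (hn : Odd n) (h : k + l = n) :
    deltaSign n k + deltaSign n l = 0 := by
  obtain ⟨m, rfl⟩ := hn
  unfold deltaSign
  split_ifs <;> omega

/-- The braid `δ_n`. -/
def deltaBraid (n : ℕ) : Braid n := descending n (deltaSign n) (n - 1)

theorem permNat_deltaBraid {n p : ℕ} (h1 : 1 ≤ p) (h2 : p ≤ n) :
    permNat n (deltaBraid n) p = if p = 1 then n else p - 1 := by
  rw [deltaBraid, permNat_descending (deltaSign_eq n) (by omega)]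
  grind

theorem permNat_deltaBraid_pow {n p l : ℕ} (h1 : 1 ≤ p) (h2 : p ≤ n) (hl : l ≤ n) :
    permNat n (deltaBraid n ^ l) p = if l < p then p - l else p + n - l := by
  induction l with
  | zero => simp; omega
  | succ l ih =>
    rw [pow_succ', map_mul, Equiv.Perm.mul_apply, ih (by omega), permNat_deltaBraid]
    all_goals grind

theorem deltaBraid_pow_mem_Pure (n : ℕ) : deltaBraid n ^ n ∈ Pure n := by
  rw [← permNat_eq_one_iff]
  ext p
  by_cases h : p = 0 ∨ n < p
  · exact permNat_of_not_mem _ _ h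
  · rw [permNat_deltaBraid_pow (by omega) (by omega) le_rfl]
    simp; omega

theorem linking_deltaBraid_pow {n p q : ℕ} (r l : ℕ) :
    (linking (deltaBraid n ^ l) p q r).a = ∑ t ∈ Finset.range l,
      (linking (deltaBraid n) (permNat n (deltaBraid n ^ t) p) (permNat n (deltaBraid n ^ t) q)
        (permNat n (deltaBraid n ^ t) r)).a := by
  induction l with
  | zero => simp [linking_one, Linking.one_def]
  | succ l ih =>
    rw [pow_succ', linking_mul, Linking.mul_def, Finset.sum_range_succ, ← ih, add_comm]

/-- In each factor `δ_n` only the strand at position 1 crosses the others. Strands `p` and `q` thus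
cross twice: at step `p - 1` with sign index `q - p`, and at step `q - 1` with sign index `n - (q -
p)`. For odd `n` these signs cancel. -/
theorem linking_deltaBraid_pow_self {n p q : ℕ} (hn : Odd n) (hpq : p < q) (r : ℕ) :
    (linking (deltaBraid n ^ n) p q r).a = 0 := by
  have hn0 : 1 ≤ n := hn.pos
  rw [linking_deltaBraid_pow]
  by_cases h : 1 ≤ p ∧ q ≤ n
  · have key : ∀ t ∈ Finset.range n, (linking (deltaBraid n) (permNat n (deltaBraid n ^ t) p)
        (permNat n (deltaBraid n ^ t) q) (permNat n (deltaBraid n ^ t) r)).a =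
        (if t = p - 1 then deltaSign n (q - p) else 0) +
          (if t = q - 1 then deltaSign n (n - (q - p)) else 0) := by
      intro t ht
      rw [Finset.mem_range] at ht
      rw [permNat_deltaBraid_pow h.1 (by omega) ht.le,
        permNat_deltaBraid_pow (by omega) h.2 ht.le, deltaBraid,
        linking_descending (deltaSign_eq n) (by omega)]
      congr 1
      · by_cases h1 : t = p - 1
        · rw [if_pos h1, if_pos (by grind)]
          congr 1
          grind
        · rw [if_neg h1, if_neg (by grind)]
      · by_cases h1 : t = q - 1
        · rw [if_pos h1, if_pos (by grind)]
          congr 1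
          grind
        · rw [if_neg h1, if_neg (by grind)]
    rw [Finset.sum_congr rfl key, Finset.sum_add_distrib, Finset.sum_ite_eq', Finset.sum_ite_eq',
      if_pos (by simp; omega), if_pos (by simp; omega)]
    exact deltaSign_add hn (by omega)
  · refine Finset.sum_eq_zero fun t _ => ?_
    rw [deltaBraid, linking_descending (deltaSign_eq n) (by omega)]
    have hp := permNat_mem_iff (descending n (deltaSign n) (n - 1) ^ t) p
    have hq := permNat_mem_iff (descending n (deltaSign n) (n - 1) ^ t) q
    rw [if_neg, if_neg] <;> omega

theorem delta_pow_mem {n : ℕ} (hn : Odd n) : delta n ^ n ∈ Gam2Quot n := by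
  rw [delta_eq hn.pos, ← QuotientGroup.mk_pow]
  exact mk_mem_Gam2Quot (mem_Gam_two_of_linking (deltaBraid_pow_mem_Pure n)
    fun p q r h => linking_deltaBraid_pow_self hn h r)

/-! ### Rotation of triples -/

/-- The sum of the entries of a triple, modulo `n`. -/
def residue {n : ℕ} (t : Triple n) : ZMod n := ((t.1.1 + t.1.2.1 + t.1.2.2 : ℕ) : ZMod n)

/-- The permutation of `δ_n` is `p ↦ p - 1` with `1 ↦ n`. If the triple contains 1, the image is out
of order by a cyclic rotation, which `triA_rotate` absorbs; the sum then changes by `n - 3` instead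
of `-3`. -/
theorem exists_conj_alpha {n : ℕ} (t : Triple n) :
    ∃ u, delta n * alpha t * (delta n)⁻¹ = alpha u ∧ residue u = residue t - 3 := by
  have h1 := Fin.lt_def.1 t.2.1
  have h2 := Fin.lt_def.1 t.2.2
  have h3 := t.1.2.2.2
  rw [delta_eq (by omega), alpha_eq_triA, triA, conj_commutator_pairA _ (by omega) (by omega)
    (by omega) (by omega) (by omega) (by omega)]
  change ∃ u, triA n (permNat n (deltaBraid n) _) (permNat n (deltaBraid n) _)
    (permNat n (deltaBraid n) _) = _ ∧ _
  rw [permNat_deltaBraid (by omega) (by omega), permNat_deltaBraid (by omega) (by omega),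
    permNat_deltaBraid (by omega) (by omega), if_neg (show ¬ (t.1.2.1 + 1 : ℕ) = 1 by omega),
    if_neg (show ¬ (t.1.2.2 + 1 : ℕ) = 1 by omega)]
  by_cases h0 : (t.1.1 : ℕ) + 1 = 1
  · rw [if_pos h0, ← triA_rotate (by omega) (by omega) (by omega) (by simp; omega)]
    obtain ⟨u, e1, e2, e3, e⟩ := exists_alpha_eq (n := n) (i := t.1.2.1 + 1 - 1)
      (j := t.1.2.2 + 1 - 1) (k := n) (by omega) (by omega) (by omega) le_rfl
    refine ⟨u, e, ?_⟩
    rw [residue, residue, eq_sub_iff_add_eq]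
    have : ((u.1.1 + u.1.2.1 + u.1.2.2 : ℕ) + 3 : ℕ) = (t.1.1 + t.1.2.1 + t.1.2.2 : ℕ) + n := by
      omega
    have := congrArg (Nat.cast : ℕ → ZMod n) this
    rw [Nat.cast_add _ 3, Nat.cast_add _ n, ZMod.natCast_self, add_zero] at this
    exact this
  · rw [if_neg h0]
    obtain ⟨u, e1, e2, e3, e⟩ := exists_alpha_eq (n := n) (i := t.1.1 + 1 - 1)
      (j := t.1.2.1 + 1 - 1) (k := t.1.2.2 + 1 - 1) (by omega) (by omega) (by omega) (by omega)
    refine ⟨u, e, ?_⟩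
    rw [residue, residue, eq_sub_iff_add_eq]
    have : ((u.1.1 + u.1.2.1 + u.1.2.2 : ℕ) + 3 : ℕ) = (t.1.1 + t.1.2.1 + t.1.2.2 : ℕ) := by
      omega
    have := congrArg (Nat.cast : ℕ → ZMod n) this
    rw [Nat.cast_add _ 3] at this
    exact this

theorem exists_rotation (n : ℕ) : ∃ ρ : Equiv.Perm (Triple n),
    (∀ t, delta n * alpha t * (delta n)⁻¹ = alpha (ρ t)) ∧ ∀ t, residue (ρ t) = residue t - 3 := by
  choose f hf using exists_conj_alpha (n := n)
  have hinj : Function.Injective f := by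
    intro t u h
    have := (hf t).1
    rw [h, ← (hf u).1] at this
    exact alpha_injective (by simpa using this)
  exact ⟨Equiv.ofBijective f (Finite.injective_iff_bijective.1 hinj), fun t => (hf t).1,
    fun t => (hf t).2⟩

theorem conj_theta {n : ℕ} {g : Quot3 n} {π : Equiv.Perm (Triple n)}
    (h : ∀ t, g * alpha t * g⁻¹ = alpha (π t)) (r : Triple n → ℤ) :
    g * theta r * g⁻¹ = theta (fun u => r (π⁻¹ u)) := by
  have h' : ∀ t, MulAut.conjNormal g (alpha' t) = alpha' (π t) := fun t => Subtype.ext (h t)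
  have e : MulAut.conjNormal g (∏ t, alpha' t ^ r t) = ∏ t, alpha' t ^ r (π⁻¹ t) := by
    rw [map_prod, ← Equiv.prod_comp π (fun t => alpha' t ^ r (π⁻¹ t))]
    simp only [map_zpow, h']
    exact Finset.prod_congr rfl fun t _ => by rw [Equiv.Perm.inv_def, Equiv.symm_apply_apply]
  rw [theta_eq_prod, theta_eq_prod, ← e]
  rfl

theorem conj_pow_alpha {n : ℕ} {ρ : Equiv.Perm (Triple n)}
    (hρ : ∀ t, delta n * alpha t * (delta n)⁻¹ = alpha (ρ t)) (l : ℕ) (t : Triple n) :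
    delta n ^ l * alpha t * (delta n ^ l)⁻¹ = alpha ((ρ ^ l) t) := by
  induction l with
  | zero => simp
  | succ l ih =>
    rw [pow_succ' ρ, Equiv.Perm.mul_apply, ← hρ, ← ih, pow_succ']
    group

theorem conj_zpow_alpha {n : ℕ} {ρ : Equiv.Perm (Triple n)}
    (hρ : ∀ t, delta n * alpha t * (delta n)⁻¹ = alpha (ρ t)) (l : ℤ) (t : Triple n) :
    delta n ^ l * alpha t * (delta n ^ l)⁻¹ = alpha ((ρ ^ l) t) := by
  rcases l.eq_nat_or_neg with ⟨l, rfl | rfl⟩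
  · simpa using conj_pow_alpha hρ l t
  · obtain ⟨u, rfl⟩ := (ρ ^ l).surjective t
    rw [← conj_pow_alpha hρ l u, zpow_neg, zpow_neg, zpow_natCast, zpow_natCast,
      Equiv.Perm.inv_def, Equiv.symm_apply_apply]
    group

theorem rotation_pow_self {n : ℕ} (hn : Odd n) {ρ : Equiv.Perm (Triple n)}
    (hρ : ∀ t, delta n * alpha t * (delta n)⁻¹ = alpha (ρ t)) : ρ ^ n = 1 := by
  ext1 t
  apply alpha_injective
  rw [← conj_pow_alpha hρ, (commute_Gam2Quot (delta_pow_mem hn) (alpha_mem t)).eq,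
    mul_inv_cancel_right]
  rfl

theorem residue_pow_inv {n : ℕ} {ρ : Equiv.Perm (Triple n)}
    (hres : ∀ t, residue (ρ t) = residue t - 3) (l : ℕ) (t : Triple n) :
    residue ((ρ ^ l)⁻¹ t) = residue t + 3 * l := by
  obtain ⟨u, rfl⟩ := (ρ ^ l).surjective t
  rw [Equiv.Perm.inv_def, Equiv.symm_apply_apply]
  induction l with
  | zero => simp
  | succ l ih =>
    rw [pow_succ', Equiv.Perm.mul_apply, hres, ih]
    push_cast
    ring

theorem mem_orbit_iff {n : ℕ} (hn : Odd n) {ρ : Equiv.Perm (Triple n)}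
    (hρ : ∀ t, delta n * alpha t * (delta n)⁻¹ = alpha (ρ t)) (t u : Triple n) :
    u ∈ orbit t ↔ ∃ l < n, (ρ ^ l)⁻¹ t = u := by
  have h0 : (n : ℤ) ≠ 0 := by have := hn.pos; omega
  simp only [orbit, Finset.mem_filter, Finset.mem_univ, true_and]
  constructor
  · rintro ⟨l, h⟩
    rw [conj_zpow_alpha hρ] at h
    -- The sign appears because the orbit is listed by inverse powers of `ρ`; reduction modulo `n`
    -- is allowed by `ρ ^ n = 1`.
    refine ⟨((-l) % n).toNat, ?_, ?_⟩
    · have := Int.emod_lt_of_pos (-l) (show (0 : ℤ) < n by have := hn.pos; omega)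
      omega
    · rw [← alpha_injective h]
      congr 1
      rw [inv_eq_iff_eq_inv, ← zpow_neg, ← zpow_natCast,
        Int.toNat_of_nonneg (Int.emod_nonneg _ h0)]
      conv_rhs => rw [← Int.emod_add_mul_ediv (-l) n, zpow_add, zpow_mul, zpow_natCast,
        rotation_pow_self hn hρ, one_zpow, mul_one]
  · rintro ⟨l, -, rfl⟩
    exact ⟨-l, by rw [conj_zpow_alpha hρ, zpow_neg, zpow_natCast]⟩

theorem natCast_mul_three_injOn {n : ℕ} (hn : Nat.Coprime n 3) (c : ZMod n) :
    Set.InjOn (fun l : ℕ => c + 3 * (l : ZMod n)) (Finset.range n) := by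
  intro l hl l' hl' h
  have h3 : IsUnit (3 : ZMod n) := (ZMod.isUnit_iff_coprime 3 n).2 hn.symm
  have := h3.mul_left_cancel (add_left_cancel h)
  rw [ZMod.natCast_eq_natCast_iff, Nat.ModEq] at this
  simp only [Finset.coe_range, Set.mem_Iio] at hl hl'
  rwa [Nat.mod_eq_of_lt hl, Nat.mod_eq_of_lt hl'] at this

theorem exists_natCast_mul_three {n : ℕ} (hn : Nat.Coprime n 3) (h0 : 0 < n) (c d : ZMod n) :
    ∃ l < n, c + 3 * (l : ZMod n) = d := by
  have : NeZero n := ⟨h0.ne'⟩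
  obtain ⟨u, hu⟩ : IsUnit (3 : ZMod n) := (ZMod.isUnit_iff_coprime 3 n).2 hn.symm
  refine ⟨((u⁻¹ : (ZMod n)ˣ) * (d - c) : ZMod n).val, ZMod.val_lt _, ?_⟩
  rw [ZMod.natCast_zmod_val, ← hu, Units.mul_inv_cancel_left]
  ring

/-- The `n` rotations of a triple have the residues `residue t + 3 l`, which are distinct as 3 is a
unit modulo `n`. Hence no orbit is shorter than `n` and no term is repeated. -/
theorem sum_orbit {n : ℕ} (hn : Odd n) (hn3 : Nat.Coprime n 3) {ρ : Equiv.Perm (Triple n)}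
    (hρ : ∀ t, delta n * alpha t * (delta n)⁻¹ = alpha (ρ t))
    (hres : ∀ t, residue (ρ t) = residue t - 3) (f : Triple n → ℤ) (t : Triple n) :
    ∑ u ∈ orbit t, f u = ∑ l ∈ Finset.range n, f ((ρ ^ l)⁻¹ t) := by
  classical
  have h : orbit t = (Finset.range n).image fun l => (ρ ^ l)⁻¹ t := by
    ext u
    simp [mem_orbit_iff hn hρ]
  rw [h, Finset.sum_image]
  intro l hl l' hl' e
  have e' := congrArg residue e
  simp only [residue_pow_inv hres] at e'
  exact natCast_mul_three_injOn hn3 (residue t) hl hl' e'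

theorem theta_mul_delta_pow {n : ℕ} {ρ : Equiv.Perm (Triple n)}
    (hρ : ∀ t, delta n * alpha t * (delta n)⁻¹ = alpha (ρ t)) (r : Triple n → ℤ) (l : ℕ) :
    (theta r * delta n) ^ l =
      theta (fun t => ∑ k ∈ Finset.range l, r ((ρ ^ k)⁻¹ t)) * delta n ^ l := by
  induction l with
  | zero =>
    simp only [Finset.range_zero, Finset.sum_empty, pow_zero, mul_one]
    exact theta_zero.symm
  | succ l ih =>
    have h := conj_theta (conj_pow_alpha hρ l) r
    have e : (fun t => ∑ k ∈ Finset.range (l + 1), r ((ρ ^ k)⁻¹ t)) =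
        (fun t => ∑ k ∈ Finset.range l, r ((ρ ^ k)⁻¹ t)) + fun t => r ((ρ ^ l)⁻¹ t) := by
      funext t
      rw [Finset.sum_range_succ]
      rfl
    rw [pow_succ, ih, e, theta_add, ← h, pow_succ]
    group

theorem theta_inclQuot_injective {s n : ℕ} (h : s ≤ n) {r r' : Triple s → ℤ}
    (e : inclQuot h (theta r) = inclQuot h (theta r')) : r = r' := by
  apply theta_injective_of_linkingQuot
  rw [← linkingQuot_inclQuot h, e, linkingQuot_inclQuot]

/-- The factor `θ(r)` is pure, while `δ_s^d` moves position `s` to `s - d`. -/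
theorem inclQuot_theta_mul_delta_pow_ne_one {s n : ℕ} (h : s ≤ n) (r : Triple s → ℤ) {d : ℕ}
    (hd : 0 < d) (hds : d < s) : inclQuot h (theta r * delta s ^ d) ≠ 1 := by
  intro e
  have e1 := linkingQuot_inclQuot h (theta r * delta s ^ d)
  rw [e, map_one] at e1
  obtain ⟨g, hg, hgr⟩ := theta_mem r
  rw [← hgr, delta_eq (by omega)] at e1
  change 1 = linkingAction s (g * deltaBraid s ^ d) at e1
  have e2 := DFunLike.congr_fun e1 ((s, s, s), 1)
  rw [linkingAction_apply, map_mul, Equiv.Perm.mul_apply, permNat_of_mem (Gam_two_le s hg),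
    permNat_deltaBraid_pow (by omega) le_rfl hds.le, if_pos hds] at e2
  have e3 := congrArg (fun x => x.1.1) e2
  simp only [Equiv.Perm.coe_one, id_eq] at e3
  omega

theorem orderOf_inclQuot {s n : ℕ} (h : s ≤ n) (hs : Odd s) (hs3 : Nat.Coprime s 3)
    {ρ : Equiv.Perm (Triple s)} (hρ : ∀ t, delta s * alpha t * (delta s)⁻¹ = alpha (ρ t))
    (hres : ∀ t, residue (ρ t) = residue t - 3) {μ : Triple s → ℤ}
    (hμ : delta s ^ s = theta μ) (r : Triple s → ℤ) :
    orderOf (inclQuot h (theta r * delta s)) = s ↔ Compatible μ r := by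
  have hpow : inclQuot h (theta r * delta s) ^ s =
      inclQuot h (theta ((fun t => ∑ u ∈ orbit t, r u) + μ)) := by
    rw [← map_pow, theta_mul_delta_pow hρ, hμ, ← theta_add]
    simp only [sum_orbit hs hs3 hρ hres]
  have hiff : inclQuot h (theta r * delta s) ^ s = 1 ↔ Compatible μ r := by
    rw [hpow]
    constructor
    · intro e t
      rw [← map_one (inclQuot h), ← theta_zero] at e
      have := congrFun (theta_inclQuot_injective h e) t
      simp only [Pi.add_apply, Pi.zero_apply] at this
      omega
    · intro hc
      have : (fun t => ∑ u ∈ orbit t, r u) + μ = 0 := by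
        funext t
        simp [hc t]
      rw [this, theta_zero, map_one]
  rw [orderOf_eq_iff hs.pos, hiff, and_iff_left]
  intro d hd hd0
  rw [← map_pow, theta_mul_delta_pow hρ]
  exact inclQuot_theta_mul_delta_pow_ne_one h _ hd0 hd

/-- Exponents whose orbit sums do not depend on `k`. -/
def family {s : ℕ} (μ : Triple s → ℤ) (k : ℤ) (t : Triple s) : ℤ :=
  (if residue t = 0 then k - μ t else 0) + (if residue t = 1 then -k else 0)

/-- Each orbit meets the residues 0 and 1 exactly once each, so the terms `k` and `-k` cancel and
only `-μ` remains. -/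
theorem family_compatible {s : ℕ} (hs : Odd s) (hs3 : Nat.Coprime s 3)
    {ρ : Equiv.Perm (Triple s)} (hρ : ∀ t, delta s * alpha t * (delta s)⁻¹ = alpha (ρ t))
    (hres : ∀ t, residue (ρ t) = residue t - 3) {μ : Triple s → ℤ}
    (hμ : ∀ t, ∀ u ∈ orbit t, μ u = μ t) (k : ℤ) : Compatible μ (family μ k) := by
  intro t
  have single : ∀ (d : ZMod s) (c : ℤ), ∑ l ∈ Finset.range s,
      (if residue t + 3 * (l : ZMod s) = d then c else 0) = c := by
    intro d c
    obtain ⟨l₀, hl₀, e⟩ := exists_natCast_mul_three hs3 hs.pos (residue t) d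
    rw [Finset.sum_eq_single l₀, if_pos e]
    · intro l hl hne
      rw [if_neg]
      intro e'
      exact hne (natCast_mul_three_injOn hs3 (residue t) hl (by simpa using hl₀) (e'.trans e.symm))
    · intro h
      exact absurd (Finset.mem_range.2 hl₀) h
  have key : ∑ u ∈ orbit t, family μ k u = ∑ u ∈ orbit t,
      ((if residue u = 0 then k - μ t else 0) + (if residue u = 1 then -k else 0)) :=
    Finset.sum_congr rfl fun u hu => by rw [family, hμ t u hu]
  rw [key, sum_orbit hs hs3 hρ hres, Finset.sum_add_distrib]
  simp only [residue_pow_inv hres]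
  rw [single, single]
  ring

theorem family_injective {s : ℕ} (hs : 3 ≤ s) (hs3 : Nat.Coprime s 3)
    {ρ : Equiv.Perm (Triple s)} (hres : ∀ t, residue (ρ t) = residue t - 3) (μ : Triple s → ℤ) :
    Function.Injective (family μ) := by
  intro k k' h
  have : Fact (1 < s) := ⟨by omega⟩
  obtain ⟨t, -⟩ := exists_alpha_eq (n := s) (i := 1) (j := 2) (k := 3) le_rfl (by omega)
    (by omega) hs
  obtain ⟨l, -, e⟩ := exists_natCast_mul_three hs3 (by omega) (residue t) 0
  -- At a rotation of `(1, 2, 3)` with residue 0 the family takes the value `k - μ`, which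
  -- determines `k`.
  have h' := congrFun h ((ρ ^ l)⁻¹ t)
  simp only [family, residue_pow_inv hres, e, if_true, zero_ne_one, if_false] at h'
  omega

end ArtinBraid

theorem mainTheorem5 (n m s : ℕ) (hm : 1 ≤ m) (hmn : m ≤ n)
    (hs : IsGreatest {d : ℕ | d ∣ m ∧ Nat.gcd d 6 = 1} s) (hs1 : 1 < s) :
    {g : ArtinBraid.Quot3 n | orderOf g = s}.Infinite ∧
    (∀ θ ∈ ArtinBraid.Gam2Quot s, ∃! r : ArtinBraid.Triple s → ℤ, θ = ArtinBraid.theta r) ∧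
    ∃ μ : ArtinBraid.Triple s → ℤ,
      ArtinBraid.delta s ^ s = ArtinBraid.theta μ ∧
      (∀ t, ∀ u ∈ ArtinBraid.orbit t, μ u = μ t) ∧
      (∀ r : ArtinBraid.Triple s → ℤ,
        ArtinBraid.theta r ∈ ArtinBraid.Gam2Quot s ∧
        (orderOf (ArtinBraid.inclQuot ((Nat.le_of_dvd hm hs.1.1).trans hmn)
            (ArtinBraid.theta r * ArtinBraid.delta s)) = s ↔ ArtinBraid.Compatible μ r)) ∧
      {g : ArtinBraid.Quot3 n | ∃ r : ArtinBraid.Triple s → ℤ, ArtinBraid.Compatible μ r ∧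
        g = ArtinBraid.inclQuot ((Nat.le_of_dvd hm hs.1.1).trans hmn)
          (ArtinBraid.theta r * ArtinBraid.delta s)}.Infinite := by
  have hsn : s ≤ n := (Nat.le_of_dvd hm hs.1.1).trans hmn
  have h6 : Nat.Coprime s 6 := hs.1.2
  have hs2 : Nat.Coprime s 2 := h6.coprime_dvd_right (by norm_num)
  have hs3 : Nat.Coprime s 3 := h6.coprime_dvd_right (by norm_num)
  have hodd : Odd s := Nat.coprime_two_right.1 hs2
  have hge : 3 ≤ s := by
    obtain ⟨k, rfl⟩ := hodd
    omega
  obtain ⟨ρ, hρ, hres⟩ := ArtinBraid.exists_rotation s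
  obtain ⟨μ, hμ⟩ := ArtinBraid.Gam2Quot_le_thetaRange s (ArtinBraid.delta_pow_mem hodd)
  have hconst : ∀ t, ∀ u ∈ ArtinBraid.orbit t, μ u = μ t := by
    intro t u hu
    obtain ⟨l, -, rfl⟩ := (ArtinBraid.mem_orbit_iff hodd hρ t u).1 hu
    have h := ArtinBraid.conj_theta (ArtinBraid.conj_pow_alpha hρ l) μ
    -- Powers of `δ_s` commute, so conjugation by `δ_s^l` fixes `θ(μ)`; uniqueness of exponents then
    -- makes `μ` invariant under `ρ^l`.
    rw [hμ, (Commute.refl _).pow_pow l s |>.eq, mul_inv_cancel_right, ← hμ] at h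
    exact (congrFun (ArtinBraid.theta_injective h) t).symm
  have hord := ArtinBraid.orderOf_inclQuot hsn hodd hs3 hρ hres hμ.symm
  have hinf : {g : ArtinBraid.Quot3 n | ∃ r : ArtinBraid.Triple s → ℤ, ArtinBraid.Compatible μ r ∧
      g = ArtinBraid.inclQuot hsn (ArtinBraid.theta r * ArtinBraid.delta s)}.Infinite := by
    refine Set.infinite_of_injective_forall_mem
      (f := fun k : ℤ => ArtinBraid.inclQuot hsn (ArtinBraid.theta (ArtinBraid.family μ k) *
        ArtinBraid.delta s)) ?_
      (fun k => ⟨_, ArtinBraid.family_compatible hodd hs3 hρ hres hconst k, rfl⟩)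
    intro k k' h
    simp only [map_mul, mul_left_inj] at h
    exact ArtinBraid.family_injective hge hs3 hres μ (ArtinBraid.theta_inclQuot_injective hsn h)
  refine ⟨hinf.mono ?_, ?_, μ, hμ.symm, hconst, fun r => ⟨ArtinBraid.theta_mem r, hord r⟩, hinf⟩
  · rintro _ ⟨r, hr, rfl⟩
    exact (hord r).2 hr
  · intro θ hθ
    obtain ⟨r, rfl⟩ := ArtinBraid.Gam2Quot_le_thetaRange s hθ
    exact ⟨r, rfl, fun r' h => (ArtinBraid.theta_injective h).symm⟩
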